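/- Let $p>3$ be a prime, $q$ a power of $p$, and $\mathbb F_q$ the field with $q$ elements. Fix a nontrivial character $\vartheta:\mathbb F_q^+\to\mathbb C^*$. Let $e_{i,j}$ be the $8\times 8$ matrix units over $\mathbb F_q$ and put $$e_1=(e_{1,2}-e_{7,8})+(e_{3,4}-e_{5,6})+(e_{3,5}-e_{4,6}),\qquad e_2=e_{2,3}-e_{6,7},$$ $$e_3=-(e_{1,3}-e_{6,8})+(e_{2,4}-e_{5,7})+(e_{2,5}-e_{4,7}),\qquad e_4=(e_{1,4}-e_{5,8})+(e_{2,6}-e_{3,7})+(e_{1,5}-e_{4,8}),$$ $$e_5=e_{1,6}-e_{3,8},\qquad e_6=e_{1,7}-e_{2,8}$$ (root vectors for the positive roots $\alpha,\beta,\alpha+\beta,2\alpha+\beta,3\alpha+\beta,3\alpha+2\beta$ of $G_2$). Let $y_i(t)=I_8+te_i+\tfrac12t^2e_i^2$, $Y_i=\{y_i(t)\mid t\in\mathbb F_q\}$, and let $U=G_2^{syl}(q)\leqslant GL_8(\mathbb F_q)$ be the group generated by all $y_i(t)$ ($1\le i\le 6$, $t\in\mathbb F_q$). Every element of $U$ is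 uniquely of the form $y(t_1,\dots,t_6)=y_2(t_2)y_1(t_1)y_3(t_3)y_4(t_4)y_5(t_5)y_6(t_6)$. A superscript $*$ means that the parameter is nonzero; all other parameters range over $\mathbb F_q$. Define the following functions on $U$, where each function in parentheses is a linear character of the pattern subgroup on which it is given. - $\chi_{lin}^{A_{12},A_{23}}(y(t_1,\dots,t_6))=\vartheta(A_{12}t_1)\vartheta(A_{23}t_2)$. - $\chi_{3,q}^{A_{13}^*}=\mathrm{Ind}_{Y_1Y_3Y_4Y_5Y_6}^U\big(y(t_1,0,t_3,t_4,t_5,t_6)\mapsto\vartheta(-A_{13}^*t_3)\big)$. - $\chi_{4,q}^{A_{15}^*,A_{23}}=\mathrm{Ind}_{Y_2Y_3Y_4Y_5Y_6}^U\big(y(0,t_2,\dots,t_6)\mapsto\vartheta(A_{23}t_2)\vartheta(2A_{15}^*t_4)\big)$. - $\chi_{5,q}^{A_{16}^*,A_{23},A_{13}}=\mathrm{Ind}_{Y_2Y_3Y_4Y_5Y_6}^U\big(y(0,t_2,\dots,t_6)\mapsto\vartheta(A_{23}t_2)\vartheta(-A_{13}t_3)\vartheta(A_{16}^*t_5)\big)$.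 - $\chi_{6,q^2}^{A_{17}^*,A_{12}}=\mathrm{Ind}_{Y_1Y_4Y_5Y_6}^U\big(y(t_1,0,0,t_4,t_5,t_6)\mapsto\vartheta(A_{12}t_1)\vartheta(A_{17}^*t_6)\big)$. Then these functions are irreducible characters of $U$, they are pairwise orthogonal (for different labels), and every complex irreducible character of $U$ is exactly one of them. The elements $$I_8,\quad y_1(t_1^*)y_6(t_6),\quad y_2(t_2^*)y_4(t_4)y_5(t_5),\quad y_2(t_2^*)y_1(t_1^*),\quad y_3(t_3^*)y_5(t_5),\quad y_4(t_4^*),\quad y_5(t_5^*),\quad y_6(t_6^*)$$ represent all conjugacy classes of $U$, each class exactly once. The character table of $U$ is as follows; in each row the values are on the above representatives, in this order. - $\chi_{lin}^{A_{12},A_{23}}$: $1$; $\vartheta(A_{12}t_1^*)$; $\vartheta(A_{23}t_2^*)$; $\vartheta(A_{12}t_1^*)\vartheta(A_{23}t_2^*)$; $1$; $1$; $1$; $1$. - $\chi_{3,q}^{A_{13}^*}$: $q$; $0$; $0$; $0$; $q\,\vartheta(-A_{13}^*t_3^*)$; $q$; $q$; $q$. - $\chi_{4,q}^{A_{15}^*,A_{23}}$: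 $q$; $0$; $\sum_{r\in\mathbb F_q}\vartheta(-2A_{15}^*t_2^*r^2)\cdot\vartheta(2A_{15}^*t_4)\vartheta(A_{23}t_2^*)$; $0$; $0$; $q\,\vartheta(2A_{15}^*t_4^*)$; $q$; $q$. - $\chi_{5,q}^{A_{16}^*,A_{23},A_{13}}$: $q$; $0$; $\sum_{r\in\mathbb F_q}\vartheta(A_{13}t_2^*r-A_{16}^*t_2^*r^3+3A_{16}^*t_4r)\cdot\vartheta(A_{16}^*t_5)\vartheta(A_{23}t_2^*)$; $0$; $\sum_{r\in\mathbb F_q}\vartheta(3A_{16}^*t_3^*r^2)\cdot\vartheta(A_{16}^*t_5)\vartheta(-A_{13}t_3^*)$; $0$; $q\,\vartheta(A_{16}^*t_5^*)$; $q$. - $\chi_{6,q^2}^{A_{17}^*,A_{12}}$: $q^2$; $\vartheta(A_{17}^*t_6)\vartheta(A_{12}t_1^*)\cdot\sum_{r\in\mathbb F_q}\vartheta(-3A_{17}^*t_1^*r^2)$; $0$; $0$; $0$; $0$; $0$; $q^2\,\vartheta(A_{17}^*t_6^*)$. -/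

import Mathlib

namespace G2Syl

/-- The complex irreducible characters of a group `G`: the characters of the irreducible
finite-dimensional complex representations of `G`. -/
def IsIrreducibleCharacter {G : Type*} [Group G] (χ : G → ℂ) : Prop :=
  ∃ (V : Type) (_ : AddCommGroup V) (_ : Module ℂ V) (_ : FiniteDimensional ℂ V)
    (ρ : Representation ℂ G V), ρ.IsIrreducible ∧ ρ.character = χ

open scoped Classical in
/-- The class function `Ind_H^G φ` induced from a function `φ` on a subgroup `H`:
`y ↦ |H|⁻¹ ∑ φ (g y g⁻¹)`, where the sum is over all `g ∈ G` with `g y g⁻¹ ∈ H`. -/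
noncomputable def induced {G : Type*} [Group G] [Fintype G] (H : Subgroup G) (φ : H → ℂ) :
    G → ℂ :=
  fun y => (Nat.card H : ℂ)⁻¹ *
    ∑ g : G, if h : g * y * g⁻¹ ∈ H then φ ⟨g * y * g⁻¹, h⟩ else 0

/-- The standard Hermitian inner product of complex-valued functions on a finite group. -/
noncomputable def characterInner {G : Type*} [Group G] [Fintype G] (χ ψ : G → ℂ) : ℂ :=
  (Fintype.card G : ℂ)⁻¹ * ∑ g : G, χ g * (starRingEnd ℂ) (ψ g)

/-- The positive roots of the root system `G₂`, for the simple roots `α` (short), `β` (long):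
`r1 = α`, `r2 = β`, `r3 = α + β`, `r4 = 2α + β`, `r5 = 3α + β`, `r6 = 3α + 2β`. -/
inductive PosRoot : Type
  | r1 | r2 | r3 | r4 | r5 | r6

open PosRoot

section Group

variable {F : Type*} [Field F]

/-- The matrix unit with `1` in position `(i, j)`, with rows and columns numbered `1, …, 8`. -/
def E (i j : ℕ) : Matrix (Fin 8) (Fin 8) F :=
  fun a b => if (a : ℕ) + 1 = i ∧ (b : ℕ) + 1 = j then 1 else 0

/-- The positive root vectors of a Chevalley basis of the Lie algebra of type `G₂` inside the
Lie algebra of type `D₄` consisting of `8 × 8` matrices. -/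
def rootVector : PosRoot → Matrix (Fin 8) (Fin 8) F
  | r1 => (E 1 2 - E 7 8) + (E 3 4 - E 5 6) + (E 3 5 - E 4 6)
  | r2 => E 2 3 - E 6 7
  | r3 => -(E 1 3 - E 6 8) + (E 2 4 - E 5 7) + (E 2 5 - E 4 7)
  | r4 => (E 1 4 - E 5 8) + (E 2 6 - E 3 7) + (E 1 5 - E 4 8)
  | r5 => E 1 6 - E 3 8
  | r6 => E 1 7 - E 2 8

/-- `exp (t e) = 1 + t e + t² e² / 2` for the root vector `e` (which satisfies `e³ = 0`);
used in characteristic different from two only. -/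
def rootMatrix (i : PosRoot) (t : F) : Matrix (Fin 8) (Fin 8) F :=
  1 + t • rootVector i + (t ^ 2 / 2) • rootVector i ^ 2

theorem rootVector_apply_eq_zero (i : PosRoot) {a b : Fin 8} (h : b ≤ a) :
    (rootVector i : Matrix (Fin 8) (Fin 8) F) a b = 0 := by
  have hE : ∀ m n : ℕ, m < n → (E m n : Matrix (Fin 8) (Fin 8) F) a b = 0 := by
    intro m n hmn
    have h' : (b : ℕ) ≤ (a : ℕ) := h
    exact if_neg (by omega)
  cases i <;> simp [rootVector, hE]

theorem det_rootMatrix (i : PosRoot) (t : F) : (rootMatrix i t).det = 1 := by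
  have hsq : ∀ a b : Fin 8, b ≤ a →
      ((rootVector i : Matrix (Fin 8) (Fin 8) F) ^ 2) a b = 0 := by
    intro a b h
    rw [pow_two, Matrix.mul_apply]
    refine Finset.sum_eq_zero fun k _ => ?_
    rcases le_or_gt k a with hk | hk
    · rw [rootVector_apply_eq_zero i hk, zero_mul]
    · rw [rootVector_apply_eq_zero i (h.trans hk.le), mul_zero]
  rw [Matrix.det_of_isUpperTriangular]
  · refine Finset.prod_eq_one fun a _ => ?_
    simp [rootMatrix, rootVector_apply_eq_zero i (le_refl a), hsq a a le_rfl]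
  · intro a b h
    have hba : b < a := h
    simp [rootMatrix, rootVector_apply_eq_zero i hba.le, hsq a b hba.le,
      Matrix.one_apply_ne hba.ne']

/-- The root element `exp (t e)` of `GL₈`. -/
noncomputable def rootGL (i : PosRoot) (t : F) : GL (Fin 8) F :=
  Matrix.GeneralLinearGroup.mkOfDetNeZero (rootMatrix i t)
    (by rw [det_rootMatrix]; exact one_ne_zero)

end Group

section

variable (F : Type*) [Field F]

/-- The Sylow `p`-subgroup `G₂^syl(q)` of the Chevalley group `G₂(q)`, as the group of matrices
generated by the positive root elements. -/
noncomputable def U : Subgroup (GL (Fin 8) F) :=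
  Subgroup.closure {g | ∃ (i : PosRoot) (t : F), g = rootGL i t}

noncomputable instance [Finite F] : Fintype (U F) := Fintype.ofFinite _

end

section Characters

variable {F : Type*} [Field F]

/-- The root element `y_i(t)`, as an element of `G₂^syl(q)`. -/
noncomputable def y (i : PosRoot) (t : F) : U F :=
  ⟨rootGL i t, Subgroup.subset_closure ⟨i, t, rfl⟩⟩

/-- The pattern subgroup generated by the root subgroups `Y_i`, `i ∈ I`. -/
noncomputable def patternSubgroup (F : Type*) [Field F] (I : Set PosRoot) : Subgroup (U F) :=
  Subgroup.closure {g | ∃ i ∈ I, ∃ t : F, g = y i t}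

/-- The matrix entry in row `i` and column `j` of an element of `G₂^syl(q)`. -/
def entry (g : U F) (i j : Fin 8) : F := ((g : GL (Fin 8) F) : Matrix (Fin 8) (Fin 8) F) i j

/-- The coordinates `t₁, …, t₆` of an element
`y₂(t₂) y₁(t₁) y₃(t₃) y₄(t₄) y₅(t₅) y₆(t₆)` of `G₂^syl(q)`, read off from its first two rows;
see `coord_prod`. -/
def coord (g : U F) : PosRoot → F
  | r1 => entry g 0 1
  | r2 => entry g 1 2
  | r3 => -entry g 0 2
  | r4 => entry g 0 3 + entry g 0 1 * entry g 0 2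
  | r5 => entry g 0 5 - entry g 0 1 * (entry g 0 3 + entry g 0 1 * entry g 0 2)
  | r6 => entry g 0 6 + entry g 0 1 * entry g 0 2 ^ 2
      + entry g 0 2 * (entry g 0 3 + entry g 0 1 * entry g 0 2)

theorem E_mul_E (i j k l : ℕ) :
    (E i j * E k l : Matrix (Fin 8) (Fin 8) F) = if j = k ∧ 1 ≤ j ∧ j ≤ 8 then E i l else 0 := by
  ext a b
  rw [Matrix.mul_apply]
  split_ifs with h
  · obtain ⟨rfl, h1, h8⟩ := h
    rw [Finset.sum_eq_single (⟨j - 1, by omega⟩ : Fin 8)]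
    · simp [E, Nat.sub_add_cancel h1, ← ite_and, and_comm]
    · intro c _ hc
      have : (c : ℕ) + 1 ≠ j := fun h => hc (Fin.ext (by simp; omega))
      simp [E, this]
    · simp
  · refine Finset.sum_eq_zero fun c _ => ?_
    have := c.isLt
    by_cases h1 : (c : ℕ) + 1 = j
    · have h2 : (c : ℕ) + 1 ≠ k := by omega
      simp [E, h2]
    · simp [E, h1]

theorem rootMatrix_eq (h2 : (2 : F) ≠ 0) (i : PosRoot) (t : F) :
    rootMatrix i t = 1 + t • rootVector i + match i with
      | r1 => -(t ^ 2 • E 3 6)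
      | r3 => -(t ^ 2 • E 2 7)
      | r4 => -(t ^ 2 • E 1 8)
      | _ => 0 := by
  have key : ∀ M : Matrix (Fin 8) (Fin 8) F, (t ^ 2 / 2) • (-M + -M) = -(t ^ 2 • M) := by
    intro M
    rw [← two_smul F, smul_smul, div_mul_cancel₀ _ h2, smul_neg]
  unfold rootMatrix
  congr 1
  cases i <;>
    simp [rootVector, pow_two, mul_add, add_mul, mul_sub, sub_mul, E_mul_E]
  all_goals rw [← pow_two, ← key, smul_add, smul_neg]

theorem coord_prod (h2 : (2 : F) ≠ 0) (t : PosRoot → F) :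
    coord (y r2 (t r2) * y r1 (t r1) * y r3 (t r3) * y r4 (t r4) * y r5 (t r5) * y r6 (t r6))
      = t := by
  have hrow : ∀ i j, entry (y r2 (t r2) * y r1 (t r1) * y r3 (t r3) * y r4 (t r4) *
      y r5 (t r5) * y r6 (t r6)) i j = Matrix.vecMul (Matrix.vecMul (Matrix.vecMul
        (Matrix.vecMul (Matrix.vecMul (rootMatrix r2 (t r2) i) (rootMatrix r1 (t r1)))
          (rootMatrix r3 (t r3))) (rootMatrix r4 (t r4))) (rootMatrix r5 (t r5)))
            (rootMatrix r6 (t r6)) j := by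
    intro i j
    change (rootMatrix r2 (t r2) * rootMatrix r1 (t r1) * rootMatrix r3 (t r3) *
      rootMatrix r4 (t r4) * rootMatrix r5 (t r5) * rootMatrix r6 (t r6)) i j = _
    simp only [Matrix.mul_apply_eq_vecMul]
  have hE : ∀ (m n : ℕ) (v : Fin 8 → F) (hm : m + 1 ≤ 8) (b : Fin 8),
      Matrix.vecMul v (E (m + 1) n) b = if (b : ℕ) + 1 = n then v ⟨m, hm⟩ else 0 := by
    intro m n v hm b
    simp only [Matrix.vecMul, dotProduct, E]
    rw [Finset.sum_eq_single (⟨m, hm⟩ : Fin 8)]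
    · simp
    · intro c _ hc
      have : (c : ℕ) ≠ m := fun h => hc (Fin.ext h)
      simp [this]
    · simp
  funext k
  cases k <;> simp only [coord, hrow, rootMatrix_eq h2, rootVector, Matrix.vecMul_add,
    Matrix.vecMul_sub, Matrix.vecMul_neg, Matrix.vecMul_smul, Matrix.vecMul_one, Matrix.vecMul_zero,
    Pi.add_apply, Pi.sub_apply, Pi.neg_apply, Pi.smul_apply, Pi.zero_apply,
    hE 0 _ _ (by norm_num), hE 1 _ _ (by norm_num), hE 2 _ _ (by norm_num),
    hE 3 _ _ (by norm_num), hE 4 _ _ (by norm_num), hE 5 _ _ (by norm_num),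
    hE 6 _ _ (by norm_num), Matrix.add_apply, Matrix.sub_apply, Matrix.smul_apply,
    Matrix.zero_apply] <;>
    simp [E, Matrix.one_apply]
  all_goals ring

/-- The labels of the rows of the character table (irreducible characters):
`lin A₁₂ A₂₃`, `chi3 A₁₃`, `chi4 A₁₅ A₂₃`, `chi5 A₁₆ A₂₃ A₁₃`, `chi6 A₁₇ A₁₂`. -/
inductive Row (F : Type*) [Field F] : Type _
  | lin (A12 A23 : F)
  | chi3 (A13 : Fˣ)
  | chi4 (A15 : Fˣ) (A23 : F)
  | chi5 (A16 : Fˣ) (A23 A13 : F)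
  | chi6 (A17 : Fˣ) (A12 : F)

/-- The labels of the columns of the character table (conjugacy classes). -/
inductive Column (F : Type*) [Field F] : Type _
  | one
  | y1y6 (t1 : Fˣ) (t6 : F)
  | y2y4y5 (t2 : Fˣ) (t4 t5 : F)
  | y2y1 (t2 t1 : Fˣ)
  | y3y5 (t3 : Fˣ) (t5 : F)
  | y4 (t4 : Fˣ)
  | y5 (t5 : Fˣ)
  | y6 (t6 : Fˣ)

/-- The representatives of the conjugacy classes. -/
noncomputable def Column.representative : Column F → U F
  | .one => 1
  | .y1y6 t1 t6 => y r1 (t1 : F) * y r6 t6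
  | .y2y4y5 t2 t4 t5 => y r2 (t2 : F) * y r4 t4 * y r5 t5
  | .y2y1 t2 t1 => y r2 (t2 : F) * y r1 (t1 : F)
  | .y3y5 t3 t5 => y r3 (t3 : F) * y r5 t5
  | .y4 t4 => y r4 (t4 : F)
  | .y5 t5 => y r5 (t5 : F)
  | .y6 t6 => y r6 (t6 : F)

/-- The characters of `G₂^syl(q)` that head the rows of the table: the linear characters, lifted
from `Y₃Y₄Y₅Y₆ \ U`, and characters induced from linear characters of `Y₁Y₃Y₄Y₅Y₆` (trivial on
`Y₄Y₅Y₆`), of `Y₂Y₃Y₄Y₅Y₆` (trivial on `Y₅Y₆`, resp. `Y₆`) and of `Y₁Y₄Y₅Y₆` (trivial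
on `Y₄Y₅`). -/
noncomputable def Row.character [Finite F] (ϑ : AddChar F ℂ) : Row F → U F → ℂ
  | .lin A12 A23 => fun u => ϑ (A12 * coord u r1) * ϑ (A23 * coord u r2)
  | .chi3 A13 => induced (patternSubgroup F {r1, r3, r4, r5, r6})
      fun h => ϑ (-((A13 : F) * coord h.1 r3))
  | .chi4 A15 A23 => induced (patternSubgroup F {r2, r3, r4, r5, r6})
      fun h => ϑ (A23 * coord h.1 r2) * ϑ (2 * (A15 : F) * coord h.1 r4)
  | .chi5 A16 A23 A13 => induced (patternSubgroup F {r2, r3, r4, r5, r6})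
      fun h => ϑ (A23 * coord h.1 r2) * ϑ (-(A13 * coord h.1 r3)) * ϑ ((A16 : F) * coord h.1 r5)
  | .chi6 A17 A12 => induced (patternSubgroup F {r1, r4, r5, r6})
      fun h => ϑ (A12 * coord h.1 r1) * ϑ ((A17 : F) * coord h.1 r6)

/-- The entries of the character table, with `q = |F|`. -/
noncomputable def tableEntry [Fintype F] (ϑ : AddChar F ℂ) : Row F → Column F → ℂ
  -- linear characters
  | .lin _ _, .one => 1
  | .lin A12 _, .y1y6 t1 _ => ϑ (A12 * t1)
  | .lin _ A23, .y2y4y5 t2 _ _ => ϑ (A23 * t2)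
  | .lin A12 A23, .y2y1 t2 t1 => ϑ (A12 * t1) * ϑ (A23 * t2)
  | .lin _ _, .y3y5 _ _ => 1
  | .lin _ _, .y4 _ => 1
  | .lin _ _, .y5 _ => 1
  | .lin _ _, .y6 _ => 1
  -- third family
  | .chi3 _, .one => Fintype.card F
  | .chi3 _, .y1y6 _ _ => 0
  | .chi3 _, .y2y4y5 _ _ _ => 0
  | .chi3 _, .y2y1 _ _ => 0
  | .chi3 A13, .y3y5 t3 _ => ϑ (-(A13 * t3 : F)) * Fintype.card F
  | .chi3 _, .y4 _ => Fintype.card F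
  | .chi3 _, .y5 _ => Fintype.card F
  | .chi3 _, .y6 _ => Fintype.card F
  -- fourth family
  | .chi4 _ _, .one => Fintype.card F
  | .chi4 _ _, .y1y6 _ _ => 0
  | .chi4 A15 A23, .y2y4y5 t2 t4 _ =>
      (∑ r : F, ϑ (-(2 * A15 * t2 * r ^ 2))) * ϑ (2 * A15 * t4) * ϑ (A23 * t2)
  | .chi4 _ _, .y2y1 _ _ => 0
  | .chi4 _ _, .y3y5 _ _ => 0
  | .chi4 A15 _, .y4 t4 => ϑ (2 * A15 * t4) * Fintype.card F
  | .chi4 _ _, .y5 _ => Fintype.card F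
  | .chi4 _ _, .y6 _ => Fintype.card F
  -- fifth family
  | .chi5 _ _ _, .one => Fintype.card F
  | .chi5 _ _ _, .y1y6 _ _ => 0
  | .chi5 A16 A23 A13, .y2y4y5 t2 t4 t5 =>
      (∑ r : F, ϑ (A13 * t2 * r - A16 * t2 * r ^ 3 + 3 * A16 * t4 * r))
        * ϑ (A16 * t5) * ϑ (A23 * t2)
  | .chi5 _ _ _, .y2y1 _ _ => 0
  | .chi5 A16 _ A13, .y3y5 t3 t5 =>
      (∑ r : F, ϑ (3 * A16 * t3 * r ^ 2)) * ϑ (A16 * t5) * ϑ (-(A13 * t3))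
  | .chi5 _ _ _, .y4 _ => 0
  | .chi5 A16 _ _, .y5 t5 => ϑ (A16 * t5 : F) * Fintype.card F
  | .chi5 _ _ _, .y6 _ => Fintype.card F
  -- sixth family
  | .chi6 _ _, .one => (Fintype.card F : ℂ) ^ 2
  | .chi6 A17 A12, .y1y6 t1 t6 =>
      ϑ (A17 * t6) * ϑ (A12 * t1) * ∑ r : F, ϑ (-(3 * A17 * t1 * r ^ 2))
  | .chi6 _ _, .y2y4y5 _ _ _ => 0
  | .chi6 _ _, .y2y1 _ _ => 0
  | .chi6 _ _, .y3y5 _ _ => 0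
  | .chi6 _ _, .y4 _ => 0
  | .chi6 _ _, .y5 _ => 0
  | .chi6 A17 _, .y6 t6 => ϑ (A17 * t6 : F) * (Fintype.card F : ℂ) ^ 2

end Characters

end G2Syl

/-! Every row is induced from a linear character `ϑ ∘ exponent` of a subgroup (the whole group for
the linear rows). By Mackey's formula, the inner product of two induced characters is a sum over
`g`. The term of `g` vanishes unless the two linear characters agree on the intersection of the
first subgroup with a conjugate of the second (`Row.Linked`). The key point is
`Row.Linked.eq_and_mem`: for rows ordered by depth, a link forces the rows to be equal and `g` to
lie in the subgroup.

To see this, one tests the link on root elements. Conjugating `y i t` changes only later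
coordinates, by explicit polynomials in the coordinates of `g`. On the root of the deepest row, a
shallower row is trivial, so the rows must have the same type and the same leading parameter. The
next tests show that the coordinates of `g` transversal to the subgroup vanish, because the
coefficients 2 and 3 are invertible. The remaining generators then identify the remaining
parameters. Hence the rows have norm one and are pairwise orthogonal. An explicit model of the
induced representation, whose endomorphism algebra has dimension equal to the norm, makes them
irreducible characters.

For the columns it is enough to show that every element is conjugate to some representative
(`exists_isConj_representative`); non-conjugacy is never checked by hand. Rows and columns are
equally numerous, namely `q³ + 2q² - q - 1`. Orthogonality makes the rows linearly independent as
functions on the columns, so they span all such functions. Therefore no two representatives are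
conjugate, and no further irreducible character exists (`existsUnique_of_card_eq`).

The values are obtained by summing over a transversal of the subgroup; the zeros come from
conjugates outside the subgroup or from sums of a nontrivial additive character. All group
computations use the normal form `mk`, with conjugation formulas obtained from products of 8 × 8
matrices. -/

namespace G2Syl

/-! ### Induction of linear characters and Mackey's criterion -/

section Induction

variable {G : Type*} [Group G]

open scoped Classical in
/-- Extension by zero of a linear character of a subgroup. -/
noncomputable def zeroExtend {H : Subgroup G} (φ : H →* ℂ) (x : G) : ℂ :=
  if h : x ∈ H then φ ⟨x, h⟩ else 0

theorem zeroExtend_of_mem {H : Subgroup G} (φ : H →* ℂ) {x : G} (h : x ∈ H) :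
    zeroExtend φ x = φ ⟨x, h⟩ := dif_pos h

theorem zeroExtend_of_notMem {H : Subgroup G} (φ : H →* ℂ) {x : G} (h : x ∉ H) :
    zeroExtend φ x = 0 := dif_neg h

theorem zeroExtend_mul {H : Subgroup G} (φ : H →* ℂ) {h : G} (hh : h ∈ H) (x : G) :
    zeroExtend φ (h * x) = zeroExtend φ h * zeroExtend φ x := by
  by_cases hx : x ∈ H
  · rw [zeroExtend_of_mem φ hh, zeroExtend_of_mem φ hx, zeroExtend_of_mem φ (H.mul_mem hh hx),
      ← map_mul]
    rfl
  · rw [zeroExtend_of_notMem φ hx, mul_zero, zeroExtend_of_notMem]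
    rwa [H.mul_mem_cancel_left hh]

theorem zeroExtend_mul_right {H : Subgroup G} (φ : H →* ℂ) {h : G} (hh : h ∈ H) (x : G) :
    zeroExtend φ (x * h) = zeroExtend φ x * zeroExtend φ h := by
  by_cases hx : x ∈ H
  · exact zeroExtend_mul φ hx h
  · rw [zeroExtend_of_notMem φ hx, zero_mul, zeroExtend_of_notMem]
    rwa [H.mul_mem_cancel_right hh]

theorem zeroExtend_one {H : Subgroup G} (φ : H →* ℂ) : zeroExtend φ (1 : G) = 1 := by
  rw [zeroExtend_of_mem φ H.one_mem]
  exact map_one φ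

theorem zeroExtend_mul_inv {H : Subgroup G} (φ : H →* ℂ) {h : G} (hh : h ∈ H) :
    zeroExtend φ h * zeroExtend φ h⁻¹ = 1 := by
  rw [← zeroExtend_mul φ hh, mul_inv_cancel, zeroExtend_one]

theorem zeroExtend_conj {H : Subgroup G} (φ : H →* ℂ) {h : G} (hh : h ∈ H) (x : G) :
    zeroExtend φ (h * x * h⁻¹) = zeroExtend φ x := by
  rw [zeroExtend_mul_right φ (H.inv_mem hh), zeroExtend_mul φ hh, mul_right_comm,
    zeroExtend_mul_inv φ hh, one_mul]

variable [Fintype G]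

theorem induced_apply {H : Subgroup G} (φ : H →* ℂ) (x : G) :
    induced H φ x = (Nat.card H : ℂ)⁻¹ * ∑ g : G, zeroExtend φ (g * x * g⁻¹) := rfl

/-- On `H` the values have finite order, hence modulus one, so conjugation is inversion; off `H`
both sides vanish. -/
theorem star_zeroExtend {H : Subgroup G} (φ : H →* ℂ) (x : G) :
    (starRingEnd ℂ) (zeroExtend φ x) = zeroExtend φ x⁻¹ := by
  by_cases hx : x ∈ H
  · have h1 : ‖zeroExtend φ x‖ = 1 := by
      rw [zeroExtend_of_mem φ hx]
      exact (φ.isOfFinOrder (isOfFinOrder_of_finite (⟨x, hx⟩ : H))).norm_eq_one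
    have h2 := zeroExtend_mul_inv φ hx
    have h3 : zeroExtend φ x * (starRingEnd ℂ) (zeroExtend φ x) = 1 := by
      rw [Complex.mul_conj, Complex.normSq_eq_norm_sq, h1]; simp
    exact mul_left_cancel₀ (left_ne_zero_of_mul_eq_one h2) (h3.trans h2.symm)
  · rw [zeroExtend_of_notMem φ hx, zeroExtend_of_notMem φ (by simpa using hx), map_zero]

theorem star_induced {H : Subgroup G} (φ : H →* ℂ) (x : G) :
    (starRingEnd ℂ) (induced H φ x) = induced H φ x⁻¹ := by
  simp only [induced_apply, map_mul, map_inv₀, map_natCast, map_sum, star_zeroExtend]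
  simp only [mul_inv_rev, inv_inv, mul_assoc]

theorem sum_zeroExtend_mul_inv {H : Subgroup G} (φ : H →* ℂ) :
    ∑ g : G, zeroExtend φ g * zeroExtend φ g⁻¹ = Nat.card H := by
  classical
  have : ∀ g : G, zeroExtend φ g * zeroExtend φ g⁻¹ = if g ∈ H then 1 else 0 := by
    intro g
    split_ifs with h
    · exact zeroExtend_mul_inv φ h
    · rw [zeroExtend_of_notMem φ h, zero_mul]
  simp only [this, Finset.sum_boole, Nat.card_eq_fintype_card, Fintype.card_subtype]

theorem card_subgroup_ne_zero (H : Subgroup G) : (Nat.card H : ℂ) ≠ 0 :=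
  Nat.cast_ne_zero.mpr Nat.card_pos.ne'

/-- The value of an induced character, as a sum over a transversal. -/
theorem induced_eq_sum_transversal {ι : Type*} [Fintype ι] {H : Subgroup G} (φ : H →* ℂ)
    (T : ι → G) (hT : ∀ g : G, ∃! i, g * (T i)⁻¹ ∈ H) (x : G) :
    induced H φ x = ∑ i, zeroExtend φ (T i * x * (T i)⁻¹) := by
  classical
  have hbij : Function.Bijective fun a : H × ι => (a.1 : G) * T a.2 := by
    constructor
    · rintro ⟨a, i⟩ ⟨b, j⟩ h
      dsimp only at h
      have hij : i = j := (hT (a * T i)).unique (by simp) (by rw [h]; simp)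
      subst hij
      exact Prod.ext (Subtype.ext (mul_right_cancel h)) rfl
    · intro g
      obtain ⟨i, hi, -⟩ := hT g
      exact ⟨(⟨_, hi⟩, i), by simp⟩
  rw [induced_apply, ← (Equiv.ofBijective _ hbij).sum_comp, Fintype.sum_prod_type]
  have : ∀ (a : H) (i : ι), zeroExtend φ ((a : G) * T i * x * ((a : G) * T i)⁻¹)
      = zeroExtend φ (T i * x * (T i)⁻¹) := by
    intro a i
    rw [← zeroExtend_conj φ a.2 (T i * x * (T i)⁻¹)]
    simp only [mul_inv_rev, mul_assoc]
  simp only [Equiv.ofBijective_apply, this, Finset.sum_const, Finset.card_univ, nsmul_eq_mul,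
    ← Nat.card_eq_fintype_card]
  rw [← mul_assoc, inv_mul_cancel₀ (card_subgroup_ne_zero H), one_mul]

/-- Mackey's formula for the inner product of two induced characters. -/
theorem characterInner_induced {H K : Subgroup G} (φ : H →* ℂ) (ψ : K →* ℂ) :
    characterInner (induced H φ) (induced K ψ) = (Nat.card H : ℂ)⁻¹ * (Nat.card K : ℂ)⁻¹ *
      ∑ g : G, ∑ h : G, zeroExtend φ h * zeroExtend ψ (g * h * g⁻¹)⁻¹ := by
  have hcard : (Fintype.card G : ℂ) ≠ 0 := Nat.cast_ne_zero.mpr Fintype.card_ne_zero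
  have key : ∑ x : G, (∑ a : G, zeroExtend φ (a * x * a⁻¹)) *
      (∑ b : G, zeroExtend ψ (b * x * b⁻¹)⁻¹) = Fintype.card G *
      ∑ g : G, ∑ h : G, zeroExtend φ h * zeroExtend ψ (g * h * g⁻¹)⁻¹ := by
    have h1 : ∀ a : G, ∑ x : G, ∑ b : G, zeroExtend φ (a * x * a⁻¹) *
        zeroExtend ψ (b * x * b⁻¹)⁻¹ =
        ∑ g : G, ∑ h : G, zeroExtend φ h * zeroExtend ψ (g * h * g⁻¹)⁻¹ := by
      intro a
      -- Substituting `b = g * a` and then `h = a * x * a⁻¹` removes the dependence on `a`.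
      rw [Finset.sum_comm, ← Equiv.sum_comp (Equiv.mulRight a)]
      refine Finset.sum_congr rfl fun g _ => ?_
      rw [← (MulAut.conj a).toEquiv.sum_comp
        fun h => zeroExtend φ h * zeroExtend ψ (g * h * g⁻¹)⁻¹]
      refine Finset.sum_congr rfl fun x _ => ?_
      simp [mul_assoc]
    simp only [Finset.sum_mul_sum]
    rw [Finset.sum_comm]
    simp only [h1, Finset.sum_const, Finset.card_univ, nsmul_eq_mul]
  unfold characterInner
  simp only [star_induced]
  simp only [induced_apply]
  have h2 : ∀ x : G, (Nat.card H : ℂ)⁻¹ * (∑ g : G, zeroExtend φ (g * x * g⁻¹)) *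
      ((Nat.card K : ℂ)⁻¹ * ∑ g : G, zeroExtend ψ (g * x⁻¹ * g⁻¹)) =
      (Nat.card H : ℂ)⁻¹ * (Nat.card K : ℂ)⁻¹ * ((∑ a : G, zeroExtend φ (a * x * a⁻¹)) *
      (∑ b : G, zeroExtend ψ (b * x * b⁻¹)⁻¹)) := by
    intro x
    simp only [mul_inv_rev, inv_inv, mul_assoc]
    ring
  simp only [h2]
  rw [← Finset.mul_sum, key]
  field_simp

/-- The sum runs over the values of a linear character on `H ∩ g⁻¹Kg`, which is nontrivial by
hypothesis: translating by the given `h` multiplies the sum by a factor other than 1. -/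
theorem sum_zeroExtend_mul_eq_zero {H K : Subgroup G} (φ : H →* ℂ) (ψ : K →* ℂ) (g : G)
    (hg : ∃ h ∈ H, g * h * g⁻¹ ∈ K ∧ zeroExtend φ h ≠ zeroExtend ψ (g * h * g⁻¹)) :
    ∑ h : G, zeroExtend φ h * zeroExtend ψ (g * h * g⁻¹)⁻¹ = 0 := by
  obtain ⟨h, hH, hK, hne⟩ := hg
  set S := ∑ h : G, zeroExtend φ h * zeroExtend ψ (g * h * g⁻¹)⁻¹ with hS
  have h1 : S = zeroExtend φ h * zeroExtend ψ (g * h * g⁻¹)⁻¹ * S := by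
    conv_lhs => rw [hS, ← Equiv.sum_comp (Equiv.mulRight h)]
    rw [hS, Finset.mul_sum]
    refine Finset.sum_congr rfl fun x _ => ?_
    have : (g * (x * h) * g⁻¹)⁻¹ = (g * h * g⁻¹)⁻¹ * (g * x * g⁻¹)⁻¹ := by group
    rw [Equiv.coe_mulRight, this, zeroExtend_mul_right φ hH, zeroExtend_mul ψ (K.inv_mem hK)]
    ring
  by_contra hne0
  apply hne
  have h2 : zeroExtend φ h * zeroExtend ψ (g * h * g⁻¹)⁻¹ = 1 :=
    mul_right_cancel₀ hne0 (by rw [← h1, one_mul])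
  have h3 := zeroExtend_mul_inv ψ hK
  exact mul_right_cancel₀ (right_ne_zero_of_mul_eq_one h3) (h2.trans h3.symm)

theorem characterInner_induced_eq_zero {H K : Subgroup G} (φ : H →* ℂ) (ψ : K →* ℂ)
    (hne : ∀ g : G, ∃ h ∈ H, g * h * g⁻¹ ∈ K ∧ zeroExtend φ h ≠ zeroExtend ψ (g * h * g⁻¹)) :
    characterInner (induced H φ) (induced K ψ) = 0 := by
  rw [characterInner_induced, Finset.sum_eq_zero, mul_zero]
  exact fun g _ => sum_zeroExtend_mul_eq_zero φ ψ g (hne g)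

/-- Only `g ∈ H` contributes to Mackey's sum, each time with `|H|`, which cancels the normalising
factors. -/
theorem characterInner_induced_self {H : Subgroup G} (φ : H →* ℂ)
    (hne : ∀ g : G, g ∉ H →
      ∃ h ∈ H, g * h * g⁻¹ ∈ H ∧ zeroExtend φ h ≠ zeroExtend φ (g * h * g⁻¹)) :
    characterInner (induced H φ) (induced H φ) = 1 := by
  classical
  rw [characterInner_induced]
  have : ∀ g : G, ∑ h : G, zeroExtend φ h * zeroExtend φ (g * h * g⁻¹)⁻¹ =
      if g ∈ H then (Nat.card H : ℂ) else 0 := by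
    intro g
    split_ifs with hg
    · rw [← sum_zeroExtend_mul_inv φ]
      refine Finset.sum_congr rfl fun h _ => ?_
      rw [← zeroExtend_conj φ hg h⁻¹]
      simp [mul_assoc]
    · exact sum_zeroExtend_mul_eq_zero φ φ g (hne g hg)
  have h0 := card_subgroup_ne_zero H
  simp only [this]
  rw [← Finset.sum_filter, Finset.sum_const, nsmul_eq_mul, ← Fintype.card_subtype,
    ← Nat.card_eq_fintype_card]
  change _ * ((Nat.card H : ℂ) * _) = 1
  field_simp

end Induction

/-! ### Irreducibility from the norm, a model of the induced representation, and counting -/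

section Representations

variable {G : Type*} [Group G] [Fintype G]

omit [Fintype G] in
theorem character_conjRingEquiv_comp {V W : Type*} [AddCommGroup V] [Module ℂ V]
    [AddCommGroup W] [Module ℂ W] (ρ : Representation ℂ G V) (e : V ≃ₗ[ℂ] W) :
    Representation.character ((e.conjRingEquiv : Module.End ℂ V →* Module.End ℂ W).comp ρ) =
      ρ.character := by
  ext g
  exact LinearMap.trace_conj' (ρ g) e

/-- A representation with one-dimensional endomorphism ring is irreducible. -/
theorem isIrreducible_of_finrank_eq_one {V : Type*} [AddCommGroup V] [Module ℂ V]
    (ρ : Representation ℂ G V)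
    (h : Module.finrank ℂ (Representation.IntertwiningMap ρ ρ) = 1) : ρ.IsIrreducible := by
  have : NeZero (Nat.card G : ℂ) := ⟨Nat.cast_ne_zero.mpr Nat.card_pos.ne'⟩
  have hnt : Nontrivial V := by
    by_contra hV
    rw [not_nontrivial_iff_subsingleton] at hV
    have : Subsingleton (Representation.IntertwiningMap ρ ρ) :=
      ⟨fun a b => DFunLike.ext _ _ fun v => Subsingleton.elim _ _⟩
    rw [Module.finrank_zero_of_subsingleton] at h
    exact zero_ne_one h
  have hne : Representation.IntertwiningMap.id ρ ≠ 0 := by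
    intro h0
    obtain ⟨v, hv⟩ := exists_ne (0 : V)
    exact hv (DFunLike.congr_fun h0 v)
  have hs := (finrank_eq_one_iff_of_nonzero' _ hne).mp h
  rw [Representation.irreducible_iff_isSimpleModule_asModule, isSimpleModule_iff]
  have hnt' : Nontrivial ρ.asModule := hnt
  refine ⟨fun p => ?_⟩
  -- Maschke's theorem gives an equivariant projection `f` onto `p`. It is a scalar `c`, and a
  -- nonzero vector of `p` forces `c = 1`, so `p` is everything.
  obtain ⟨f, hf⟩ := MonoidAlgebra.exists_leftInverse_of_injective p.subtype p.ker_subtype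
  obtain ⟨c, hc⟩ := hs
    ((Representation.IntertwiningMap.equivLinearMapAsModule ρ ρ).symm (p.subtype ∘ₗ f))
  have hc' : ∀ v : ρ.asModule, (f v : ρ.asModule) = (c • v : ρ.asModule) := fun v =>
    (DFunLike.congr_fun hc v).symm
  by_cases hp : p = ⊥
  · exact Or.inl hp
  · right
    obtain ⟨v, hv, hv0⟩ := p.exists_mem_ne_zero_of_ne_bot hp
    have h1 : f v = ⟨v, hv⟩ := LinearMap.congr_fun hf ⟨v, hv⟩
    have h2 : (1 : ℂ) • v = c • v := by rw [← hc', h1, one_smul]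
    have h3 : (1 : ℂ) = c := smul_left_injective ℂ hv0 h2
    refine Submodule.eq_top_iff'.mpr fun w => ?_
    have h4 := hc' w
    rw [← h3, one_smul] at h4
    rw [← h4]
    exact (f w).2

/-- The normalised sum is the dimension of the space of self-intertwiners. -/
theorem isIrreducible_of_norm_one {V : Type*} [AddCommGroup V] [Module ℂ V]
    [FiniteDimensional ℂ V] (ρ : Representation ℂ G V)
    (h : (Fintype.card G : ℂ)⁻¹ * ∑ g : G, ρ.character g * ρ.character g⁻¹ = 1) :
    ρ.IsIrreducible := by
  have : Invertible (Nat.card G : ℂ) :=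
    invertibleOfNonzero (Nat.cast_ne_zero.mpr Nat.card_pos.ne')
  apply isIrreducible_of_finrank_eq_one
  have h1 := Representation.card_inv_mul_sum_char_mul_char_eq_finrank ρ ρ
  rw [Nat.card_eq_fintype_card, h] at h1
  exact_mod_cast h1.symm

theorem isIrreducibleCharacter_of_norm_one {V : Type*} [AddCommGroup V] [Module ℂ V]
    [FiniteDimensional ℂ V] (ρ : Representation ℂ G V)
    (h : (Fintype.card G : ℂ)⁻¹ * ∑ g : G, ρ.character g * ρ.character g⁻¹ = 1) :
    IsIrreducibleCharacter ρ.character := by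
  -- `IsIrreducibleCharacter` asks for a space in `Type`, so the representation is moved to a
  -- coordinate space.
  have hχ := character_conjRingEquiv_comp ρ (Module.finBasis ℂ V).equivFun
  exact ⟨_, inferInstance, inferInstance, inferInstance, _,
    isIrreducible_of_norm_one _ (by rw [hχ, h]), hχ⟩

open scoped Classical in
/-- The operator `f ↦ (x ↦ |H|⁻¹ ∑ φ (x g z⁻¹) f z)`: the translation by `g`, composed with the
projection onto the space of the representation induced from `φ`. -/
noncomputable def inducedOperator {H : Subgroup G} (φ : H →* ℂ) (g : G) :
    (G → ℂ) →ₗ[ℂ] (G → ℂ) :=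
  Matrix.toLin' (Matrix.of fun x z => (Nat.card H : ℂ)⁻¹ * zeroExtend φ (x * g * z⁻¹))

theorem inducedOperator_apply {H : Subgroup G} (φ : H →* ℂ) (g : G) (f : G → ℂ) (x : G) :
    inducedOperator φ g f x =
      ∑ z, (Nat.card H : ℂ)⁻¹ * zeroExtend φ (x * g * z⁻¹) * f z := by
  simp [inducedOperator, Matrix.mulVec, dotProduct]

theorem trace_inducedOperator {H : Subgroup G} (φ : H →* ℂ) (g : G) :
    LinearMap.trace ℂ (G → ℂ) (inducedOperator φ g) = induced H φ g := by
  classical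
  rw [inducedOperator, Matrix.trace_toLin'_eq, induced_apply, Finset.mul_sum]
  rfl

/-- The space of the representation induced from `φ`. -/
def inducedSpace {H : Subgroup G} (φ : H →* ℂ) : Submodule ℂ (G → ℂ) where
  carrier := {f | ∀ h : H, ∀ x : G, f (h * x) = φ h * f x}
  add_mem' := by
    intro a b ha hb h x
    simp only [Pi.add_apply, ha h x, hb h x, mul_add]
  zero_mem' := by intro h x; simp
  smul_mem' := by
    intro c f hf h x
    simp only [Pi.smul_apply, smul_eq_mul, hf h x]
    ring

theorem inducedOperator_mem {H : Subgroup G} (φ : H →* ℂ) (g : G) (f : G → ℂ) :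
    inducedOperator φ g f ∈ inducedSpace φ := by
  intro h x
  simp only [inducedOperator_apply, Finset.mul_sum]
  refine Finset.sum_congr rfl fun z _ => ?_
  rw [mul_assoc (h : G), mul_assoc (h : G), zeroExtend_mul φ h.2, zeroExtend_of_mem φ h.2]
  ring

/-- Averaging against `φ` over `H` is the identity on equivariant functions, so only the translation
by `g` remains. -/
theorem inducedOperator_of_mem {H : Subgroup G} (φ : H →* ℂ) (g : G) {f : G → ℂ}
    (hf : f ∈ inducedSpace φ) (x : G) : inducedOperator φ g f x = f (x * g) := by
  classical
  have hcard := card_subgroup_ne_zero H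
  -- The new variable is `k = x * g * z⁻¹`, that is, `z = k⁻¹ * (x * g)`.
  rw [inducedOperator_apply, ← ((Equiv.inv G).trans (Equiv.mulRight (x * g))).sum_comp]
  have : ∀ k : G, zeroExtend φ k * f (k⁻¹ * (x * g)) =
      zeroExtend φ k * zeroExtend φ k⁻¹ * f (x * g) := by
    intro k
    by_cases hk : k ∈ H
    · have := hf ⟨k⁻¹, H.inv_mem hk⟩ (x * g)
      rw [show k⁻¹ * (x * g) = ((⟨k⁻¹, H.inv_mem hk⟩ : H) : G) * (x * g) from rfl, this,
        zeroExtend_of_mem φ (H.inv_mem hk), mul_assoc]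
    · rw [zeroExtend_of_notMem φ hk]; simp
  calc _ = ∑ k : G, (Nat.card H : ℂ)⁻¹ * (zeroExtend φ k * f (k⁻¹ * (x * g))) := by
        refine Finset.sum_congr rfl fun k _ => ?_
        simp [mul_assoc]
    _ = f (x * g) := by
        simp only [this]
        rw [← Finset.mul_sum, ← Finset.sum_mul, sum_zeroExtend_mul_inv,
          inv_mul_cancel_left₀ hcard]

/-- The representation induced from a linear character `φ`, on functions by right translation. -/
noncomputable def inducedRepresentation {H : Subgroup G} (φ : H →* ℂ) :
    Representation ℂ G (inducedSpace φ) where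
  toFun g := (inducedOperator φ g).restrict fun f _ => inducedOperator_mem φ g f
  map_one' := by
    ext f x
    simp [inducedOperator_of_mem φ _ f.2]
  map_mul' g h := by
    ext f x
    simp [inducedOperator_of_mem φ _ f.2, inducedOperator_of_mem φ _ (inducedOperator_mem φ _ _),
      mul_assoc]

/-- The operator on all functions has its range in the induced space, so restricting to that space
does not change the trace. -/
theorem character_inducedRepresentation {H : Subgroup G} (φ : H →* ℂ) :
    (inducedRepresentation φ).character = induced H φ := by
  ext g
  rw [← trace_inducedOperator]
  exact LinearMap.trace_restrict_eq_of_forall_mem _ _ (inducedOperator_mem φ g)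

theorem isIrreducibleCharacter_induced {H : Subgroup G} (φ : H →* ℂ)
    (h : characterInner (induced H φ) (induced H φ) = 1) :
    IsIrreducibleCharacter (induced H φ) := by
  rw [← character_inducedRepresentation φ]
  apply isIrreducibleCharacter_of_norm_one
  rw [← h]
  simp only [characterInner, star_induced, character_inducedRepresentation]

omit [Fintype G] in
theorem IsIrreducibleCharacter.apply_conj {χ : G → ℂ} (h : IsIrreducibleCharacter χ) (x g : G) :
    χ (g * x * g⁻¹) = χ x := by
  obtain ⟨V, _, _, _, ρ, -, rfl⟩ := h
  exact ρ.char_conj x g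

omit [Fintype G] in
theorem IsIrreducibleCharacter.apply_one_ne_zero {χ : G → ℂ} (h : IsIrreducibleCharacter χ) :
    χ 1 ≠ 0 := by
  obtain ⟨V, _, _, _, ρ, hρ, rfl⟩ := h
  rw [ρ.char_one, Nat.cast_ne_zero]
  intro h0
  have : Subsingleton V := Module.finrank_zero_iff.mp h0
  refine bot_ne_top (α := Subrepresentation ρ) ?_
  ext v
  rw [Subsingleton.elim v 0]
  exact ⟨fun _ => Submodule.zero_mem _, fun _ => Submodule.zero_mem _⟩

theorem IsIrreducibleCharacter.sum_mul_inv_eq_zero {χ ψ : G → ℂ} (hχ : IsIrreducibleCharacter χ)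
    (hψ : IsIrreducibleCharacter ψ) (hne : χ ≠ ψ) : ∑ g, χ g * ψ g⁻¹ = 0 := by
  obtain ⟨V, _, _, _, ρ, _, rfl⟩ := hχ
  obtain ⟨W, _, _, _, σ, _, rfl⟩ := hψ
  have hcard : (Nat.card G : ℂ) ≠ 0 := Nat.cast_ne_zero.mpr Nat.card_pos.ne'
  have : Invertible (Nat.card G : ℂ) := invertibleOfNonzero hcard
  have h := Representation.char_orthonormal ρ σ
  rw [if_neg fun ⟨e⟩ => hne (Representation.char_iso e).symm] at h
  exact (mul_eq_zero.mp h).resolve_left (inv_ne_zero hcard)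

theorem IsIrreducibleCharacter.sum_mul_inv_ne_zero {χ : G → ℂ} (hχ : IsIrreducibleCharacter χ) :
    ∑ g, χ g * χ g⁻¹ ≠ 0 := by
  obtain ⟨V, _, _, _, ρ, _, rfl⟩ := hχ
  have : Invertible (Nat.card G : ℂ) :=
    invertibleOfNonzero (Nat.cast_ne_zero.mpr Nat.card_pos.ne')
  have h := Representation.char_orthonormal ρ ρ
  rw [if_pos ⟨Representation.Equiv.refl ρ⟩] at h
  exact right_ne_zero_of_mul_eq_one h

/-- If as many irreducible characters as representatives meeting all conjugacy classes are given,
then these are all irreducible characters, and the representatives are not redundant. -/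
theorem existsUnique_of_card_eq {R C : Type*} [Fintype R] [Fintype C]
    (hcard : Fintype.card R = Fintype.card C) (χ : R → G → ℂ) (rep : C → G)
    (hirr : ∀ i, IsIrreducibleCharacter (χ i)) (hinj : Function.Injective χ)
    (hrep : ∀ g, ∃ c, IsConj (rep c) g) :
    (∀ g, ∃! c, IsConj (rep c) g) ∧ ∀ ψ, IsIrreducibleCharacter ψ → ∃! i, χ i = ψ := by
  classical
  have hclass : ∀ {ψ : G → ℂ}, IsIrreducibleCharacter ψ → ∀ {x z : G}, IsConj x z → ψ x = ψ z := by
    intro ψ hψ x z hxz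
    obtain ⟨g, rfl⟩ := isConj_iff.mp hxz
    exact (hψ.apply_conj x g).symm
  have horth : ∀ i j, i ≠ j → ∑ g, χ i g * χ j g⁻¹ = 0 := fun i j hij =>
    (hirr i).sum_mul_inv_eq_zero (hirr j) (hinj.ne hij)
  let v : R → C → ℂ := fun i c => χ i (rep c)
  have hext : ∀ (a : R → ℂ) (ψ : G → ℂ), IsIrreducibleCharacter ψ →
      (∀ c, ∑ i, a i * v i c = ψ (rep c)) → ∀ g, ∑ i, a i * χ i g = ψ g := by
    intro a ψ hψ h g
    obtain ⟨c, hc⟩ := hrep g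
    rw [← hclass hψ hc, ← h c]
    exact Finset.sum_congr rfl fun i _ => by rw [← hclass (hirr i) hc]
  have hcoef : ∀ (a : R → ℂ) (j : R), ∑ g, (∑ i, a i * χ i g) * χ j g⁻¹ =
      a j * ∑ g, χ j g * χ j g⁻¹ := by
    intro a j
    simp only [Finset.sum_mul]
    rw [Finset.sum_comm, Finset.sum_eq_single j]
    · rw [Finset.mul_sum]
      exact Finset.sum_congr rfl fun g _ => mul_assoc _ _ _
    · intro i _ hij
      simp only [mul_assoc]
      rw [← Finset.mul_sum, horth i j hij, mul_zero]
    · simp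
  -- A relation on representatives extends to the whole group, since characters are class functions;
  -- pairing with `χ j` isolates `a j`.
  have hli : LinearIndependent ℂ v := by
    rw [Fintype.linearIndependent_iff]
    intro a ha j
    have h0 : ∀ g, ∑ i, a i * χ i g = 0 := by
      intro g
      obtain ⟨c, hc⟩ := hrep g
      have := congrFun ha c
      simp only [Finset.sum_apply, Pi.smul_apply, smul_eq_mul, Pi.zero_apply] at this
      rw [← this]
      exact Finset.sum_congr rfl fun i _ => by rw [← hclass (hirr i) hc]
    have := hcoef a j
    simp only [h0, zero_mul, Finset.sum_const_zero] at this
    exact (mul_eq_zero.mp this.symm).resolve_right (hirr j).sum_mul_inv_ne_zero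
  have hspan : ∀ f : C → ℂ, ∃ a : R → ℂ, ∑ i, a i • v i = f := by
    intro f
    have htop : Submodule.span ℂ (Set.range v) = ⊤ :=
      hli.span_eq_top_of_card_eq_finrank' (by rw [hcard, Module.finrank_fintype_fun_eq_card])
    exact (Submodule.mem_span_range_iff_exists_fun ℂ).mp (htop ▸ Submodule.mem_top)
  constructor
  · intro g
    obtain ⟨c, hc⟩ := hrep g
    refine ⟨c, hc, fun d hd => ?_⟩
    by_contra hdc
    -- A combination of class functions cannot be 1 at `rep c` and 0 at the conjugate element `rep
    -- d`.
    obtain ⟨a, ha⟩ := hspan (Pi.single c 1)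
    have h1 : (∑ i, a i • v i) d = (∑ i, a i • v i) c := by
      simp only [Finset.sum_apply, Pi.smul_apply]
      exact Finset.sum_congr rfl fun i _ => by
        rw [show v i d = v i c from hclass (hirr i) (hd.trans hc.symm)]
    rw [ha, Pi.single_eq_same, Pi.single_eq_of_ne hdc] at h1
    exact zero_ne_one h1
  · intro ψ hψ
    suffices h : ∃ i, χ i = ψ from h.elim fun i hi => ⟨i, hi, fun j hj => hinj (hj.trans hi.symm)⟩
    by_contra! hne
    -- A missing `ψ` would be a combination of the rows and yet orthogonal to all of them, hence
    -- zero, contradicting `ψ 1 ≠ 0`.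
    obtain ⟨a, ha⟩ := hspan fun c => ψ (rep c)
    have h1 := hext a ψ hψ fun c => by
      simpa only [Finset.sum_apply, Pi.smul_apply, smul_eq_mul] using congrFun ha c
    have h2 : ∀ j, a j = 0 := by
      intro j
      have := hcoef a j
      simp only [h1] at this
      rw [hψ.sum_mul_inv_eq_zero (hirr j) (hne j).symm] at this
      exact (mul_eq_zero.mp this.symm).resolve_right (hirr j).sum_mul_inv_ne_zero
    apply hψ.apply_one_ne_zero
    rw [← h1]
    simp [h2]

end Representations

open PosRoot

/-! ### Normal form, products and conjugation in the group -/

section Coordinates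

variable {F : Type*} [Field F]

/-- The matrix of `y₂(a₂) y₁(a₁) y₃(a₃) y₄(a₄) y₅(a₅) y₆(a₆)`. -/
def coordMatrix (a1 a2 a3 a4 a5 a6 : F) : Matrix (Fin 8) (Fin 8) F :=
  !![1, a1, -a3, a4 + a1 * a3, a4 + a1 * a3, a5 + a1 * a4, a6 + a3 * a4 - a1 * a3 ^ 2,
      -a1 * a6 + a3 * a5 - a4 ^ 2 - 2 * a1 * a3 * a4;
    0, 1, a2, a3 + a1 * a2, a3 + a1 * a2, a4 - a1 ^ 2 * a2,
      -a2 * a4 - a3 ^ 2 - 2 * a1 * a2 * a3,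
      -a6 - a2 * a5 - 2 * a3 * a4 - 2 * a1 * a2 * a4 - a1 ^ 2 * a2 * a3;
    0, 0, 1, a1, a1, -a1 ^ 2, -a4 - 2 * a1 * a3, -a5 - 2 * a1 * a4 - a1 ^ 2 * a3;
    0, 0, 0, 1, 0, -a1, -a3, -a4 - a1 * a3;
    0, 0, 0, 0, 1, -a1, -a3, -a4 - a1 * a3;
    0, 0, 0, 0, 0, 1, -a2, a3 + a1 * a2;
    0, 0, 0, 0, 0, 0, 1, -a1;
    0, 0, 0, 0, 0, 0, 0, 1]

theorem rootMatrix_r1 (h2 : (2 : F) ≠ 0) (s : F) :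
    rootMatrix r1 s = coordMatrix s 0 0 0 0 0 := by
  rw [rootMatrix_eq h2]
  ext i j
  fin_cases i <;> fin_cases j <;> simp [coordMatrix, rootVector, E]

/-- Used with a symbolic row, so that the product of two 8 × 8 matrices is computed row by row. -/
theorem vecMul_r1 (x0 x1 x2 x3 x4 x5 x6 x7 s : F) :
    Matrix.vecMul ![x0, x1, x2, x3, x4, x5, x6, x7] (coordMatrix s 0 0 0 0 0) =
      ![x0, x1 + s * x0, x2, x3 + s * x2, x4 + s * x2, x5 - s * x3 - s * x4 - s ^ 2 * x2, x6,
        x7 - s * x6] := by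
  ext j
  fin_cases j <;> simp [coordMatrix, Matrix.vecMul, dotProduct, Fin.sum_univ_succ] <;> ring

/-- This formula and its analogues for the other roots play the role of the Chevalley commutator
relations. -/
theorem coordMatrix_mul_r1 (a1 a2 a3 a4 a5 a6 s : F) :
    coordMatrix a1 a2 a3 a4 a5 a6 * coordMatrix s 0 0 0 0 0 =
      coordMatrix (a1 + s) a2 a3 (a4 - 2 * a3 * s) (a5 - 3 * a4 * s + 3 * a3 * s ^ 2) (a6 +
        3 * a3 ^ 2 * s) := by
  rw [coordMatrix]
  simp only [Matrix.cons_mul, Matrix.empty_mul, vecMul_r1, Equiv.symm_apply_apply]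
  simp only [coordMatrix, EmbeddingLike.apply_eq_iff_eq, Matrix.vecCons_inj]
  repeat' apply And.intro
  all_goals first | trivial | ring

theorem rootMatrix_r2 (h2 : (2 : F) ≠ 0) (s : F) :
    rootMatrix r2 s = coordMatrix 0 s 0 0 0 0 := by
  rw [rootMatrix_eq h2]
  ext i j
  fin_cases i <;> fin_cases j <;> simp [coordMatrix, rootVector, E]

theorem vecMul_r2 (x0 x1 x2 x3 x4 x5 x6 x7 s : F) :
    Matrix.vecMul ![x0, x1, x2, x3, x4, x5, x6, x7] (coordMatrix 0 s 0 0 0 0) =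
      ![x0, x1, x2 + s * x1, x3, x4, x5, x6 - s * x5, x7] := by
  ext j
  fin_cases j <;> simp [coordMatrix, Matrix.vecMul, dotProduct, Fin.sum_univ_succ] <;> ring

theorem coordMatrix_mul_r2 (a1 a2 a3 a4 a5 a6 s : F) :
    coordMatrix a1 a2 a3 a4 a5 a6 * coordMatrix 0 s 0 0 0 0 =
      coordMatrix a1 (a2 + s) (a3 - a1 * s) (a4 + a1 ^ 2 * s) (a5 - a1 ^ 3 * s) (a6 - a5 * s -
        3 * a1 ^ 2 * a3 * s + 2 * a1 ^ 3 * s ^ 2) := by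
  rw [coordMatrix]
  simp only [Matrix.cons_mul, Matrix.empty_mul, vecMul_r2, Equiv.symm_apply_apply]
  simp only [coordMatrix, EmbeddingLike.apply_eq_iff_eq, Matrix.vecCons_inj]
  repeat' apply And.intro
  all_goals first | trivial | ring

theorem rootMatrix_r3 (h2 : (2 : F) ≠ 0) (s : F) :
    rootMatrix r3 s = coordMatrix 0 0 s 0 0 0 := by
  rw [rootMatrix_eq h2]
  ext i j
  fin_cases i <;> fin_cases j <;> simp [coordMatrix, rootVector, E]

theorem vecMul_r3 (x0 x1 x2 x3 x4 x5 x6 x7 s : F) :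
    Matrix.vecMul ![x0, x1, x2, x3, x4, x5, x6, x7] (coordMatrix 0 0 s 0 0 0) =
      ![x0, x1, x2 - s * x0, x3 + s * x1, x4 + s * x1, x5, x6 - s * x3 - s * x4 - s ^ 2 * x1,
        x7 + s * x5] := by
  ext j
  fin_cases j <;> simp [coordMatrix, Matrix.vecMul, dotProduct, Fin.sum_univ_succ] <;> ring

theorem coordMatrix_mul_r3 (a1 a2 a3 a4 a5 a6 s : F) :
    coordMatrix a1 a2 a3 a4 a5 a6 * coordMatrix 0 0 s 0 0 0 =
      coordMatrix a1 a2 (a3 + s) a4 a5 (a6 - 3 * a4 * s) := by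
  rw [coordMatrix]
  simp only [Matrix.cons_mul, Matrix.empty_mul, vecMul_r3, Equiv.symm_apply_apply]
  simp only [coordMatrix, EmbeddingLike.apply_eq_iff_eq, Matrix.vecCons_inj]
  repeat' apply And.intro
  all_goals first | trivial | ring

theorem rootMatrix_r4 (h2 : (2 : F) ≠ 0) (s : F) :
    rootMatrix r4 s = coordMatrix 0 0 0 s 0 0 := by
  rw [rootMatrix_eq h2]
  ext i j
  fin_cases i <;> fin_cases j <;> simp [coordMatrix, rootVector, E]

theorem vecMul_r4 (x0 x1 x2 x3 x4 x5 x6 x7 s : F) :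
    Matrix.vecMul ![x0, x1, x2, x3, x4, x5, x6, x7] (coordMatrix 0 0 0 s 0 0) =
      ![x0, x1, x2, x3 + s * x0, x4 + s * x0, x5 + s * x1, x6 - s * x2, x7 - s * x3 - s * x4 -
        s ^ 2 * x0] := by
  ext j
  fin_cases j <;> simp [coordMatrix, Matrix.vecMul, dotProduct, Fin.sum_univ_succ] <;> ring

theorem coordMatrix_mul_r4 (a1 a2 a3 a4 a5 a6 s : F) :
    coordMatrix a1 a2 a3 a4 a5 a6 * coordMatrix 0 0 0 s 0 0 =
      coordMatrix a1 a2 a3 (a4 + s) a5 a6 := by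
  rw [coordMatrix]
  simp only [Matrix.cons_mul, Matrix.empty_mul, vecMul_r4, Equiv.symm_apply_apply]
  simp only [coordMatrix, EmbeddingLike.apply_eq_iff_eq, Matrix.vecCons_inj]
  repeat' apply And.intro
  all_goals first | trivial | ring

theorem rootMatrix_r5 (h2 : (2 : F) ≠ 0) (s : F) :
    rootMatrix r5 s = coordMatrix 0 0 0 0 s 0 := by
  rw [rootMatrix_eq h2]
  ext i j
  fin_cases i <;> fin_cases j <;> simp [coordMatrix, rootVector, E]

theorem vecMul_r5 (x0 x1 x2 x3 x4 x5 x6 x7 s : F) :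
    Matrix.vecMul ![x0, x1, x2, x3, x4, x5, x6, x7] (coordMatrix 0 0 0 0 s 0) =
      ![x0, x1, x2, x3, x4, x5 + s * x0, x6, x7 - s * x2] := by
  ext j
  fin_cases j <;> simp [coordMatrix, Matrix.vecMul, dotProduct, Fin.sum_univ_succ] <;> ring

theorem coordMatrix_mul_r5 (a1 a2 a3 a4 a5 a6 s : F) :
    coordMatrix a1 a2 a3 a4 a5 a6 * coordMatrix 0 0 0 0 s 0 =
      coordMatrix a1 a2 a3 a4 (a5 + s) a6 := by
  rw [coordMatrix]
  simp only [Matrix.cons_mul, Matrix.empty_mul, vecMul_r5, Equiv.symm_apply_apply]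
  simp only [coordMatrix, EmbeddingLike.apply_eq_iff_eq, Matrix.vecCons_inj]
  repeat' apply And.intro
  all_goals first | trivial | ring

theorem rootMatrix_r6 (h2 : (2 : F) ≠ 0) (s : F) :
    rootMatrix r6 s = coordMatrix 0 0 0 0 0 s := by
  rw [rootMatrix_eq h2]
  ext i j
  fin_cases i <;> fin_cases j <;> simp [coordMatrix, rootVector, E]

theorem vecMul_r6 (x0 x1 x2 x3 x4 x5 x6 x7 s : F) :
    Matrix.vecMul ![x0, x1, x2, x3, x4, x5, x6, x7] (coordMatrix 0 0 0 0 0 s) =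
      ![x0, x1, x2, x3, x4, x5, x6 + s * x0, x7 - s * x1] := by
  ext j
  fin_cases j <;> simp [coordMatrix, Matrix.vecMul, dotProduct, Fin.sum_univ_succ] <;> ring

theorem coordMatrix_mul_r6 (a1 a2 a3 a4 a5 a6 s : F) :
    coordMatrix a1 a2 a3 a4 a5 a6 * coordMatrix 0 0 0 0 0 s =
      coordMatrix a1 a2 a3 a4 a5 (a6 + s) := by
  rw [coordMatrix]
  simp only [Matrix.cons_mul, Matrix.empty_mul, vecMul_r6, Equiv.symm_apply_apply]
  simp only [coordMatrix, EmbeddingLike.apply_eq_iff_eq, Matrix.vecCons_inj]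
  repeat' apply And.intro
  all_goals first | trivial | ring

/-- The element `y₂(a₂) y₁(a₁) y₃(a₃) y₄(a₄) y₅(a₅) y₆(a₆)`. -/
noncomputable def mk (a1 a2 a3 a4 a5 a6 : F) : U F :=
  y r2 a2 * y r1 a1 * y r3 a3 * y r4 a4 * y r5 a5 * y r6 a6

theorem coe_mk (h2 : (2 : F) ≠ 0) (a1 a2 a3 a4 a5 a6 : F) :
    ((mk a1 a2 a3 a4 a5 a6 : GL (Fin 8) F) : Matrix (Fin 8) (Fin 8) F) =
      coordMatrix a1 a2 a3 a4 a5 a6 := by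
  change rootMatrix r2 a2 * rootMatrix r1 a1 * rootMatrix r3 a3 * rootMatrix r4 a4 *
    rootMatrix r5 a5 * rootMatrix r6 a6 = _
  rw [rootMatrix_r1 h2, rootMatrix_r2 h2, rootMatrix_r3 h2, rootMatrix_r4 h2, rootMatrix_r5 h2,
    rootMatrix_r6 h2, coordMatrix_mul_r1, coordMatrix_mul_r3, coordMatrix_mul_r4,
    coordMatrix_mul_r5, coordMatrix_mul_r6]
  congr 1 <;> ring

theorem U_ext {g h : U F} (H : ((g : GL (Fin 8) F) : Matrix (Fin 8) (Fin 8) F) =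
    ((h : GL (Fin 8) F) : Matrix (Fin 8) (Fin 8) F)) : g = h :=
  Subtype.ext (Units.ext H)

@[simp] theorem coord_mk_r1 (h2 : (2 : F) ≠ 0) (a1 a2 a3 a4 a5 a6 : F) :
    coord (mk a1 a2 a3 a4 a5 a6) r1 = a1 :=
  congrFun (coord_prod h2 fun i => match i with
    | r1 => a1 | r2 => a2 | r3 => a3 | r4 => a4 | r5 => a5 | r6 => a6) r1

@[simp] theorem coord_mk_r2 (h2 : (2 : F) ≠ 0) (a1 a2 a3 a4 a5 a6 : F) :
    coord (mk a1 a2 a3 a4 a5 a6) r2 = a2 :=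
  congrFun (coord_prod h2 fun i => match i with
    | r1 => a1 | r2 => a2 | r3 => a3 | r4 => a4 | r5 => a5 | r6 => a6) r2

@[simp] theorem coord_mk_r3 (h2 : (2 : F) ≠ 0) (a1 a2 a3 a4 a5 a6 : F) :
    coord (mk a1 a2 a3 a4 a5 a6) r3 = a3 :=
  congrFun (coord_prod h2 fun i => match i with
    | r1 => a1 | r2 => a2 | r3 => a3 | r4 => a4 | r5 => a5 | r6 => a6) r3

@[simp] theorem coord_mk_r4 (h2 : (2 : F) ≠ 0) (a1 a2 a3 a4 a5 a6 : F) :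
    coord (mk a1 a2 a3 a4 a5 a6) r4 = a4 :=
  congrFun (coord_prod h2 fun i => match i with
    | r1 => a1 | r2 => a2 | r3 => a3 | r4 => a4 | r5 => a5 | r6 => a6) r4

@[simp] theorem coord_mk_r5 (h2 : (2 : F) ≠ 0) (a1 a2 a3 a4 a5 a6 : F) :
    coord (mk a1 a2 a3 a4 a5 a6) r5 = a5 :=
  congrFun (coord_prod h2 fun i => match i with
    | r1 => a1 | r2 => a2 | r3 => a3 | r4 => a4 | r5 => a5 | r6 => a6) r5

@[simp] theorem coord_mk_r6 (h2 : (2 : F) ≠ 0) (a1 a2 a3 a4 a5 a6 : F) :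
    coord (mk a1 a2 a3 a4 a5 a6) r6 = a6 :=
  congrFun (coord_prod h2 fun i => match i with
    | r1 => a1 | r2 => a2 | r3 => a3 | r4 => a4 | r5 => a5 | r6 => a6) r6

theorem coe_mul_y (g : U F) (i : PosRoot) (s : F) :
    (((g * y i s : U F) : GL (Fin 8) F) : Matrix (Fin 8) (Fin 8) F) =
      ((g : GL (Fin 8) F) : Matrix (Fin 8) (Fin 8) F) * rootMatrix i s := rfl

theorem y_zero (i : PosRoot) : y i (0 : F) = 1 :=
  U_ext (by simp [y, rootGL, rootMatrix])

theorem y1_eq (s : F) : y r1 s = mk s 0 0 0 0 0 := by simp [mk, y_zero]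

theorem y2_eq (s : F) : y r2 s = mk 0 s 0 0 0 0 := by simp [mk, y_zero]

theorem y3_eq (s : F) : y r3 s = mk 0 0 s 0 0 0 := by simp [mk, y_zero]

theorem y4_eq (s : F) : y r4 s = mk 0 0 0 s 0 0 := by simp [mk, y_zero]

theorem y5_eq (s : F) : y r5 s = mk 0 0 0 0 s 0 := by simp [mk, y_zero]

theorem y6_eq (s : F) : y r6 s = mk 0 0 0 0 0 s := by simp [mk, y_zero]

theorem mk_congr {a1 a2 a3 a4 a5 a6 b1 b2 b3 b4 b5 b6 : F} (e1 : a1 = b1) (e2 : a2 = b2)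
    (e3 : a3 = b3) (e4 : a4 = b4) (e5 : a5 = b5) (e6 : a6 = b6) :
    mk a1 a2 a3 a4 a5 a6 = mk b1 b2 b3 b4 b5 b6 := by
  rw [e1, e2, e3, e4, e5, e6]

variable (h2 : (2 : F) ≠ 0)
include h2

theorem mk_mul_y1 (a1 a2 a3 a4 a5 a6 s : F) : mk a1 a2 a3 a4 a5 a6 * y r1 s =
    mk (a1 + s) a2 a3 (a4 - 2 * a3 * s) (a5 - 3 * a4 * s + 3 * a3 * s ^ 2)
      (a6 + 3 * a3 ^ 2 * s) :=
  U_ext (by rw [coe_mul_y, coe_mk h2, coe_mk h2, rootMatrix_r1 h2, coordMatrix_mul_r1])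

theorem mk_mul_y2 (a1 a2 a3 a4 a5 a6 s : F) : mk a1 a2 a3 a4 a5 a6 * y r2 s =
    mk a1 (a2 + s) (a3 - a1 * s) (a4 + a1 ^ 2 * s) (a5 - a1 ^ 3 * s)
      (a6 - a5 * s - 3 * a1 ^ 2 * a3 * s + 2 * a1 ^ 3 * s ^ 2) :=
  U_ext (by rw [coe_mul_y, coe_mk h2, coe_mk h2, rootMatrix_r2 h2, coordMatrix_mul_r2])

theorem mk_mul_y3 (a1 a2 a3 a4 a5 a6 s : F) : mk a1 a2 a3 a4 a5 a6 * y r3 s =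
    mk a1 a2 (a3 + s) a4 a5 (a6 - 3 * a4 * s) :=
  U_ext (by rw [coe_mul_y, coe_mk h2, coe_mk h2, rootMatrix_r3 h2, coordMatrix_mul_r3])

theorem mk_mul_y4 (a1 a2 a3 a4 a5 a6 s : F) : mk a1 a2 a3 a4 a5 a6 * y r4 s =
    mk a1 a2 a3 (a4 + s) a5 a6 :=
  U_ext (by rw [coe_mul_y, coe_mk h2, coe_mk h2, rootMatrix_r4 h2, coordMatrix_mul_r4])

theorem mk_mul_y5 (a1 a2 a3 a4 a5 a6 s : F) : mk a1 a2 a3 a4 a5 a6 * y r5 s =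
    mk a1 a2 a3 a4 (a5 + s) a6 :=
  U_ext (by rw [coe_mul_y, coe_mk h2, coe_mk h2, rootMatrix_r5 h2, coordMatrix_mul_r5])

theorem mk_mul_y6 (a1 a2 a3 a4 a5 a6 s : F) : mk a1 a2 a3 a4 a5 a6 * y r6 s =
    mk a1 a2 a3 a4 a5 (a6 + s) :=
  U_ext (by rw [coe_mul_y, coe_mk h2, coe_mk h2, rootMatrix_r6 h2, coordMatrix_mul_r6])

theorem mk_zero : mk (0 : F) 0 0 0 0 0 = 1 := by
  refine U_ext ?_
  rw [coe_mk h2]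
  ext i j
  fin_cases i <;> fin_cases j <;> simp [coordMatrix]

theorem inv_y (i : PosRoot) (s : F) : (y i s)⁻¹ = y i (-s) := by
  rw [inv_eq_iff_mul_eq_one]
  cases i
  · rw [y1_eq, mk_mul_y1 h2, ← mk_zero h2]; apply mk_congr <;> ring
  · rw [y2_eq, mk_mul_y2 h2, ← mk_zero h2]; apply mk_congr <;> ring
  · rw [y3_eq, mk_mul_y3 h2, ← mk_zero h2]; apply mk_congr <;> ring
  · rw [y4_eq, mk_mul_y4 h2, ← mk_zero h2]; apply mk_congr <;> ring
  · rw [y5_eq, mk_mul_y5 h2, ← mk_zero h2]; apply mk_congr <;> ring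
  · rw [y6_eq, mk_mul_y6 h2, ← mk_zero h2]; apply mk_congr <;> ring

theorem exists_mk_mul_y (a1 a2 a3 a4 a5 a6 : F) (i : PosRoot) (s : F) :
    ∃ b1 b2 b3 b4 b5 b6 : F, mk a1 a2 a3 a4 a5 a6 * y i s = mk b1 b2 b3 b4 b5 b6 := by
  cases i
  · exact ⟨_, _, _, _, _, _, mk_mul_y1 h2 ..⟩
  · exact ⟨_, _, _, _, _, _, mk_mul_y2 h2 ..⟩
  · exact ⟨_, _, _, _, _, _, mk_mul_y3 h2 ..⟩
  · exact ⟨_, _, _, _, _, _, mk_mul_y4 h2 ..⟩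
  · exact ⟨_, _, _, _, _, _, mk_mul_y5 h2 ..⟩
  · exact ⟨_, _, _, _, _, _, mk_mul_y6 h2 ..⟩

/-- Normal forms contain 1 and are stable under right multiplication by root elements, whose
inverses are again root elements. -/
theorem exists_mk (g : U F) : ∃ a1 a2 a3 a4 a5 a6 : F, g = mk a1 a2 a3 a4 a5 a6 := by
  obtain ⟨g, hg⟩ := g
  have step : ∀ (x : U F) (i : PosRoot) (s : F),
      (∃ a1 a2 a3 a4 a5 a6 : F, x = mk a1 a2 a3 a4 a5 a6) →
      ∃ a1 a2 a3 a4 a5 a6 : F, x * y i s = mk a1 a2 a3 a4 a5 a6 := by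
    rintro x i s ⟨a1, a2, a3, a4, a5, a6, rfl⟩
    exact exists_mk_mul_y h2 a1 a2 a3 a4 a5 a6 i s
  induction hg using Subgroup.closure_induction_right with
  | one => exact ⟨0, 0, 0, 0, 0, 0, (mk_zero h2).symm⟩
  | mul_right x hx z hz ih =>
    obtain ⟨i, t, rfl⟩ := hz
    exact step _ i t ih
  | mul_inv_cancel x hx z hz ih =>
    obtain ⟨i, t, rfl⟩ := hz
    have := step _ i (-t) ih
    rw [← inv_y h2] at this
    exact this

theorem patternSubgroup_induction {I : Set PosRoot} {p : U F → Prop} (one : p 1)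
    (mul : ∀ (a1 a2 a3 a4 a5 a6 : F) (i : PosRoot) (s : F), i ∈ I → p (mk a1 a2 a3 a4 a5 a6) →
      p (mk a1 a2 a3 a4 a5 a6 * y i s)) {g : U F} (hg : g ∈ patternSubgroup F I) : p g := by
  have step : ∀ (x : U F) (i : PosRoot) (s : F), i ∈ I → p x → p (x * y i s) := by
    intro x i s hi hx
    obtain ⟨a1, a2, a3, a4, a5, a6, rfl⟩ := exists_mk h2 x
    exact mul a1 a2 a3 a4 a5 a6 i s hi hx
  induction hg using Subgroup.closure_induction_right with
  | one => exact one
  | mul_right x hx z hz ih =>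
    obtain ⟨i, hi, t, rfl⟩ := hz
    exact step x i t hi ih
  | mul_inv_cancel x hx z hz ih =>
    obtain ⟨i, hi, t, rfl⟩ := hz
    rw [inv_y h2]
    exact step x i (-t) hi ih

omit h2 in
theorem y_mem_patternSubgroup {I : Set PosRoot} {i : PosRoot} (hi : i ∈ I) (s : F) :
    y i s ∈ patternSubgroup F I :=
  Subgroup.subset_closure ⟨i, hi, s, rfl⟩

/-- Right multiplication by the allowed generators never changes the coordinate in question. The
next two subgroups are recognised in the same way. -/
theorem mk_mem_pattern13456 (a1 a2 a3 a4 a5 a6 : F) :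
    mk a1 a2 a3 a4 a5 a6 ∈ patternSubgroup F {r1, r3, r4, r5, r6} ↔ a2 = 0 := by
  constructor
  · intro h
    have : coord (mk a1 a2 a3 a4 a5 a6) r2 = 0 := by
      refine patternSubgroup_induction (p := fun g => coord g r2 = 0) h2 ?_ ?_ h
      · rw [← mk_zero h2, coord_mk_r2 h2]
      · intro b1 b2 b3 b4 b5 b6 i s hi hb
        rw [coord_mk_r2 h2] at hb
        rcases hi with rfl | rfl | rfl | rfl | rfl <;>
          simp [mk_mul_y1, mk_mul_y3, mk_mul_y4, mk_mul_y5, mk_mul_y6, h2, hb]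
    rwa [coord_mk_r2 h2] at this
  · rintro rfl
    rw [mk, y_zero, one_mul]
    refine mul_mem (mul_mem (mul_mem (mul_mem ?_ ?_) ?_) ?_) ?_ <;>
      exact y_mem_patternSubgroup (by simp) _

theorem mk_mem_pattern23456 (a1 a2 a3 a4 a5 a6 : F) :
    mk a1 a2 a3 a4 a5 a6 ∈ patternSubgroup F {r2, r3, r4, r5, r6} ↔ a1 = 0 := by
  constructor
  · intro h
    have : coord (mk a1 a2 a3 a4 a5 a6) r1 = 0 := by
      refine patternSubgroup_induction (p := fun g => coord g r1 = 0) h2 ?_ ?_ h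
      · rw [← mk_zero h2, coord_mk_r1 h2]
      · intro b1 b2 b3 b4 b5 b6 i s hi hb
        rw [coord_mk_r1 h2] at hb
        rcases hi with rfl | rfl | rfl | rfl | rfl <;>
          simp [mk_mul_y2, mk_mul_y3, mk_mul_y4, mk_mul_y5, mk_mul_y6, h2, hb]
    rwa [coord_mk_r1 h2] at this
  · rintro rfl
    rw [mk, y_zero, mul_one]
    refine mul_mem (mul_mem (mul_mem (mul_mem ?_ ?_) ?_) ?_) ?_ <;>
      exact y_mem_patternSubgroup (by simp) _

theorem mk_mem_pattern1456 (a1 a2 a3 a4 a5 a6 : F) :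
    mk a1 a2 a3 a4 a5 a6 ∈ patternSubgroup F {r1, r4, r5, r6} ↔ a2 = 0 ∧ a3 = 0 := by
  constructor
  · intro h
    have : coord (mk a1 a2 a3 a4 a5 a6) r2 = 0 ∧ coord (mk a1 a2 a3 a4 a5 a6) r3 = 0 := by
      refine patternSubgroup_induction (p := fun g => coord g r2 = 0 ∧ coord g r3 = 0) h2 ?_ ?_ h
      · rw [← mk_zero h2, coord_mk_r2 h2, coord_mk_r3 h2]
        exact ⟨rfl, rfl⟩
      · intro b1 b2 b3 b4 b5 b6 i s hi hb
        rw [coord_mk_r2 h2, coord_mk_r3 h2] at hb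
        rcases hi with rfl | rfl | rfl | rfl <;>
          simp [mk_mul_y1, mk_mul_y4, mk_mul_y5, mk_mul_y6, h2, hb]
    rwa [coord_mk_r2 h2, coord_mk_r3 h2] at this
  · rintro ⟨rfl, rfl⟩
    rw [mk, y_zero, y_zero, one_mul, mul_one]
    refine mul_mem (mul_mem (mul_mem ?_ ?_) ?_) ?_ <;>
      exact y_mem_patternSubgroup (by simp) _

omit h2 in
theorem mul_mk (g : U F) (b1 b2 b3 b4 b5 b6 : F) : g * mk b1 b2 b3 b4 b5 b6 =
    g * y r2 b2 * y r1 b1 * y r3 b3 * y r4 b4 * y r5 b5 * y r6 b6 := by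
  simp only [mk, mul_assoc]

theorem conj_y1 (s a1 a2 a3 a4 a5 a6 : F) :
    y r1 s * mk a1 a2 a3 a4 a5 a6 * (y r1 s)⁻¹ =
    mk a1 a2 (a3 - a2 * s) (a4 + 2 * a3 * s + 2 * a1 * a2 * s - a2 * s ^ 2)
      (a5 + 3 * a4 * s + 3 * a3 * s ^ 2 + 3 * a1 * a2 * s ^ 2 - 3 * a1 ^ 2 * a2 * s - a2 * s ^ 3)
      (a6 - 3 * a3 ^ 2 * s - 6 * a1 * a2 * a3 * s + 3 * a2 * a3 * s ^ 2 +
        3 * a1 * a2 ^ 2 * s ^ 2 - a2 ^ 2 * s ^ 3) := by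
  -- In the form `y s * g = g' * y s`, both sides are built by right multiplications from a normal
  -- form.
  rw [mul_inv_eq_iff_eq_mul]
  conv_lhs => rw [mul_mk, y1_eq]
  simp only [mk_mul_y1 h2, mk_mul_y2 h2, mk_mul_y3 h2, mk_mul_y4 h2, mk_mul_y5 h2, mk_mul_y6 h2]
  apply mk_congr <;> ring

theorem conj_y2 (s a1 a2 a3 a4 a5 a6 : F) :
    y r2 s * mk a1 a2 a3 a4 a5 a6 * (y r2 s)⁻¹ =
    mk a1 a2 (a3 + a1 * s) (a4 - a1 ^ 2 * s) (a5 + a1 ^ 3 * s)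
      (a6 + a5 * s + 3 * a1 ^ 2 * a3 * s + 2 * a1 ^ 3 * s ^ 2) := by
  rw [mul_inv_eq_iff_eq_mul]
  conv_lhs => rw [mul_mk, y2_eq]
  simp only [mk_mul_y1 h2, mk_mul_y2 h2, mk_mul_y3 h2, mk_mul_y4 h2, mk_mul_y5 h2, mk_mul_y6 h2]
  apply mk_congr <;> ring

theorem conj_y3 (s a1 a2 a3 a4 a5 a6 : F) :
    y r3 s * mk a1 a2 a3 a4 a5 a6 * (y r3 s)⁻¹ =
    mk a1 a2 a3 (a4 - 2 * a1 * s) (a5 + 3 * a1 ^ 2 * s)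
      (a6 + 3 * a4 * s + 6 * a1 * a3 * s - 3 * a1 * s ^ 2) := by
  rw [mul_inv_eq_iff_eq_mul]
  conv_lhs => rw [mul_mk, y3_eq]
  simp only [mk_mul_y1 h2, mk_mul_y2 h2, mk_mul_y3 h2, mk_mul_y4 h2, mk_mul_y5 h2, mk_mul_y6 h2]
  apply mk_congr <;> ring

theorem conj_y4 (s a1 a2 a3 a4 a5 a6 : F) :
    y r4 s * mk a1 a2 a3 a4 a5 a6 * (y r4 s)⁻¹ =
    mk a1 a2 a3 a4 (a5 - 3 * a1 * s) (a6 - 3 * a3 * s) := by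
  rw [mul_inv_eq_iff_eq_mul]
  conv_lhs => rw [mul_mk, y4_eq]
  simp only [mk_mul_y1 h2, mk_mul_y2 h2, mk_mul_y3 h2, mk_mul_y4 h2, mk_mul_y5 h2, mk_mul_y6 h2]
  apply mk_congr <;> ring

theorem conj_y5 (s a1 a2 a3 a4 a5 a6 : F) :
    y r5 s * mk a1 a2 a3 a4 a5 a6 * (y r5 s)⁻¹ =
    mk a1 a2 a3 a4 a5 (a6 - a2 * s) := by
  rw [mul_inv_eq_iff_eq_mul]
  conv_lhs => rw [mul_mk, y5_eq]
  simp only [mk_mul_y1 h2, mk_mul_y2 h2, mk_mul_y3 h2, mk_mul_y4 h2, mk_mul_y5 h2, mk_mul_y6 h2]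
  apply mk_congr <;> ring

theorem conj_y6 (s a1 a2 a3 a4 a5 a6 : F) :
    y r6 s * mk a1 a2 a3 a4 a5 a6 * (y r6 s)⁻¹ =
    mk a1 a2 a3 a4 a5 a6 := by
  rw [mul_inv_eq_iff_eq_mul]
  conv_lhs => rw [mul_mk, y6_eq]
  simp only [mk_mul_y1 h2, mk_mul_y2 h2, mk_mul_y3 h2, mk_mul_y4 h2, mk_mul_y5 h2, mk_mul_y6 h2]
  apply mk_congr <;> ring

end Coordinates

/-! ### Every element is conjugate to a representative -/

section ConjugacyClasses

variable {F : Type*} [Field F]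

theorem representative_y1y6 (t1 : Fˣ) (t6 : F) :
    (Column.y1y6 t1 t6).representative = mk (t1 : F) 0 0 0 0 t6 := by
  simp [Column.representative, mk, y_zero]

theorem representative_y2y4y5 (t2 : Fˣ) (t4 t5 : F) :
    (Column.y2y4y5 t2 t4 t5).representative = mk 0 (t2 : F) 0 t4 t5 0 := by
  simp [Column.representative, mk, y_zero]

theorem representative_y2y1 (t2 t1 : Fˣ) :
    (Column.y2y1 t2 t1).representative = mk (t1 : F) (t2 : F) 0 0 0 0 := by
  simp [Column.representative, mk, y_zero]

theorem representative_y3y5 (t3 : Fˣ) (t5 : F) :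
    (Column.y3y5 t3 t5).representative = mk 0 0 (t3 : F) 0 t5 0 := by
  simp [Column.representative, mk, y_zero]

theorem representative_y4 (t4 : Fˣ) :
    (Column.y4 t4).representative = mk 0 0 0 (t4 : F) 0 0 := by
  simp [Column.representative, mk, y_zero]

theorem representative_y5 (t5 : Fˣ) :
    (Column.y5 t5).representative = mk 0 0 0 0 (t5 : F) 0 := by
  simp [Column.representative, mk, y_zero]

theorem representative_y6 (t6 : Fˣ) :
    (Column.y6 t6).representative = mk 0 0 0 0 0 (t6 : F) := by
  simp [Column.representative, mk, y_zero]

variable (h2 : (2 : F) ≠ 0)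
include h2

theorem exists_isConj_r3_eq_zero_of_r2 {a2 : F} (h : a2 ≠ 0) (a1 a3 a4 a5 a6 : F) :
    ∃ b4 b5 b6, IsConj (mk a1 a2 0 b4 b5 b6) (mk a1 a2 a3 a4 a5 a6) :=
  ⟨_, _, _, (isConj_iff.mpr ⟨y r1 (a3 / a2), (conj_y1 h2 ..).trans
    (mk_congr rfl rfl (by field_simp; ring) rfl rfl rfl)⟩).symm⟩

theorem exists_isConj_r3_eq_zero_of_r1 {a1 : F} (h : a1 ≠ 0) (a2 a3 a4 a5 a6 : F) :
    ∃ b4 b5 b6, IsConj (mk a1 a2 0 b4 b5 b6) (mk a1 a2 a3 a4 a5 a6) :=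
  ⟨_, _, _, (isConj_iff.mpr ⟨y r2 (-a3 / a1), (conj_y2 h2 ..).trans
    (mk_congr rfl rfl (by field_simp; ring) rfl rfl rfl)⟩).symm⟩

theorem exists_isConj_r4_eq_zero {a1 : F} (h : a1 ≠ 0) (a2 a3 a4 a5 a6 : F) :
    ∃ b5 b6, IsConj (mk a1 a2 a3 0 b5 b6) (mk a1 a2 a3 a4 a5 a6) :=
  ⟨_, _, (isConj_iff.mpr ⟨y r3 (a4 / (2 * a1)), (conj_y3 h2 ..).trans
    (mk_congr rfl rfl rfl (by field_simp; ring) rfl rfl)⟩).symm⟩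

theorem exists_isConj_r5_eq_zero (h3 : (3 : F) ≠ 0) {a1 : F} (h : a1 ≠ 0) (a2 a3 a4 a5 a6 : F) :
    ∃ b6, IsConj (mk a1 a2 a3 a4 0 b6) (mk a1 a2 a3 a4 a5 a6) :=
  ⟨_, (isConj_iff.mpr ⟨y r4 (a5 / (3 * a1)), (conj_y4 h2 ..).trans
    (mk_congr rfl rfl rfl rfl (by field_simp; ring) rfl)⟩).symm⟩

theorem isConj_r6_eq_zero {a2 : F} (h : a2 ≠ 0) (a1 a3 a4 a5 a6 : F) :
    IsConj (mk a1 a2 a3 a4 a5 0) (mk a1 a2 a3 a4 a5 a6) :=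
  (isConj_iff.mpr ⟨y r5 (a6 / a2), (conj_y5 h2 ..).trans
    (mk_congr rfl rfl rfl rfl rfl (by field_simp; ring))⟩).symm

theorem exists_isConj_representative (h3 : (3 : F) ≠ 0) (g : U F) :
    ∃ c : Column F, IsConj c.representative g := by
  obtain ⟨a1, a2, a3, a4, a5, a6, rfl⟩ := exists_mk h2 g
  by_cases h_1 : a1 = 0
  · subst h_1
    by_cases h_2 : a2 = 0
    · subst h_2
      by_cases h_3 : a3 = 0
      · subst h_3
        by_cases h_4 : a4 = 0
        · subst h_4
          by_cases h_5 : a5 = 0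
          · subst h_5
            by_cases h_6 : a6 = 0
            · subst h_6
              exact ⟨.one, by rw [mk_zero h2]; exact IsConj.refl 1⟩
            · exact ⟨.y6 (Units.mk0 a6 h_6), by rw [representative_y6]; exact IsConj.refl _⟩
          · refine ⟨.y5 (Units.mk0 a5 h_5), ?_⟩
            rw [representative_y5]
            -- Here and below, the parameter of the conjugating root element solves the linear
            -- equation that makes the chosen coordinate zero.
            exact (isConj_iff.mpr ⟨y r2 (-a6 / a5), (conj_y2 h2 ..).trans (mk_congr rfl rfl
              (by simp) (by simp) (by simp) (by field_simp; ring))⟩).symm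
        · refine ⟨.y4 (Units.mk0 a4 h_4), ?_⟩
          rw [representative_y4]
          have e1 : IsConj (mk 0 0 0 a4 0 a6) (mk 0 0 0 a4 a5 a6) :=
            (isConj_iff.mpr ⟨y r1 (-a5 / (3 * a4)), (conj_y1 h2 ..).trans (mk_congr rfl rfl
              (by simp) (by simp) (by field_simp; ring) (by simp))⟩).symm
          have e2 : IsConj (mk 0 0 0 a4 0 0) (mk 0 0 0 a4 0 a6) :=
            (isConj_iff.mpr ⟨y r3 (-a6 / (3 * a4)), (conj_y3 h2 ..).trans (mk_congr rfl rfl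
              (by simp) (by simp) (by simp) (by field_simp; ring))⟩).symm
          exact e2.trans e1
      -- Conjugation by `y r1` removes the fourth coordinate at the expense of the later ones; then
      -- `y r4` removes the sixth and, as `a1 = 0`, keeps the fifth.
      · obtain ⟨b5, b6, e1⟩ : ∃ b5 b6, IsConj (mk 0 0 a3 0 b5 b6) (mk 0 0 a3 a4 a5 a6) :=
          ⟨_, _, (isConj_iff.mpr ⟨y r1 (-a4 / (2 * a3)), (conj_y1 h2 ..).trans (mk_congr rfl rfl
            (by simp) (by field_simp; ring) rfl rfl)⟩).symm⟩
        refine ⟨.y3y5 (Units.mk0 a3 h_3) b5, ?_⟩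
        rw [representative_y3y5]
        have e2 : IsConj (mk 0 0 a3 0 b5 0) (mk 0 0 a3 0 b5 b6) :=
          (isConj_iff.mpr ⟨y r4 (b6 / (3 * a3)), (conj_y4 h2 ..).trans (mk_congr rfl rfl
            rfl rfl (by simp) (by field_simp; ring))⟩).symm
        exact e2.trans e1
    · obtain ⟨b4, b5, b6, e1⟩ := exists_isConj_r3_eq_zero_of_r2 h2 h_2 0 a3 a4 a5 a6
      refine ⟨.y2y4y5 (Units.mk0 a2 h_2) b4 b5, ?_⟩
      rw [representative_y2y4y5]
      exact (isConj_r6_eq_zero h2 h_2 ..).trans e1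
  -- With `a1 ≠ 0`, conjugation by `y r2`, `y r3`, `y r4` clears the coordinates 3, 4, 5 in this
  -- order, each step preserving the zeros already made; `y r5` clears the sixth if `a2 ≠ 0`.
  · obtain ⟨b4, b5, b6, e1⟩ := exists_isConj_r3_eq_zero_of_r1 h2 h_1 a2 a3 a4 a5 a6
    obtain ⟨c5, c6, e2⟩ := exists_isConj_r4_eq_zero h2 h_1 a2 0 b4 b5 b6
    obtain ⟨d6, e3⟩ := exists_isConj_r5_eq_zero h2 h3 h_1 a2 0 0 c5 c6
    have e := e3.trans (e2.trans e1)
    by_cases h_2 : a2 = 0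
    · subst h_2
      exact ⟨.y1y6 (Units.mk0 a1 h_1) d6, by rw [representative_y1y6]; exact e⟩
    · exact ⟨.y2y1 (Units.mk0 a2 h_2) (Units.mk0 a1 h_1), by
        rw [representative_y2y1]; exact (isConj_r6_eq_zero h2 h_2 ..).trans e⟩

end ConjugacyClasses

/-! ### Equal numbers of rows and columns -/

section Cardinalities

variable (F : Type*) [Field F]

/-- The rows of the table, as a disjoint union of parameter sets. -/
def rowEquiv : Row F ≃ (F × F) ⊕ Fˣ ⊕ (Fˣ × F) ⊕ (Fˣ × F × F) ⊕ (Fˣ × F) where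
  toFun
    | .lin a b => .inl (a, b)
    | .chi3 a => .inr (.inl a)
    | .chi4 a b => .inr (.inr (.inl (a, b)))
    | .chi5 a b c => .inr (.inr (.inr (.inl (a, b, c))))
    | .chi6 a b => .inr (.inr (.inr (.inr (a, b))))
  invFun
    | .inl (a, b) => .lin a b
    | .inr (.inl a) => .chi3 a
    | .inr (.inr (.inl (a, b))) => .chi4 a b
    | .inr (.inr (.inr (.inl (a, b, c)))) => .chi5 a b c
    | .inr (.inr (.inr (.inr (a, b)))) => .chi6 a b
  left_inv x := by cases x <;> rfl
  right_inv x := by rcases x with ⟨a, b⟩ | a | ⟨a, b⟩ | ⟨a, b, c⟩ | ⟨a, b⟩ <;> rfl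

/-- The columns of the table, as a disjoint union of parameter sets. -/
def columnEquiv : Column F ≃
    Unit ⊕ (Fˣ × F) ⊕ (Fˣ × F × F) ⊕ (Fˣ × Fˣ) ⊕ (Fˣ × F) ⊕ Fˣ ⊕ Fˣ ⊕ Fˣ where
  toFun
    | .one => .inl ()
    | .y1y6 a b => .inr (.inl (a, b))
    | .y2y4y5 a b c => .inr (.inr (.inl (a, b, c)))
    | .y2y1 a b => .inr (.inr (.inr (.inl (a, b))))
    | .y3y5 a b => .inr (.inr (.inr (.inr (.inl (a, b)))))
    | .y4 a => .inr (.inr (.inr (.inr (.inr (.inl a)))))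
    | .y5 a => .inr (.inr (.inr (.inr (.inr (.inr (.inl a))))))
    | .y6 a => .inr (.inr (.inr (.inr (.inr (.inr (.inr a))))))
  invFun
    | .inl _ => .one
    | .inr (.inl (a, b)) => .y1y6 a b
    | .inr (.inr (.inl (a, b, c))) => .y2y4y5 a b c
    | .inr (.inr (.inr (.inl (a, b)))) => .y2y1 a b
    | .inr (.inr (.inr (.inr (.inl (a, b))))) => .y3y5 a b
    | .inr (.inr (.inr (.inr (.inr (.inl a))))) => .y4 a
    | .inr (.inr (.inr (.inr (.inr (.inr (.inl a)))))) => .y5 a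
    | .inr (.inr (.inr (.inr (.inr (.inr (.inr a)))))) => .y6 a
  left_inv x := by cases x <;> rfl
  right_inv x := by
    rcases x with _ | ⟨a, b⟩ | ⟨a, b, c⟩ | ⟨a, b⟩ | ⟨a, b⟩ | a | a | a <;> rfl

variable [Fintype F]

open scoped Classical in
noncomputable instance : Fintype (Row F) := Fintype.ofEquiv _ (rowEquiv F).symm

open scoped Classical in
noncomputable instance : Fintype (Column F) := Fintype.ofEquiv _ (columnEquiv F).symm

theorem card_row_eq_card_column : Fintype.card (Row F) = Fintype.card (Column F) := by
  classical
  rw [Fintype.card_congr (rowEquiv F), Fintype.card_congr (columnEquiv F)]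
  have h : Fintype.card F = Fintype.card Fˣ + 1 := by
    rw [Fintype.card_units, Nat.sub_add_cancel Fintype.card_pos]
  simp only [Fintype.card_sum, Fintype.card_prod, h, Fintype.card_unit]
  ring

end Cardinalities

/-! ### Nontrivial additive characters -/

section AdditiveCharacters

variable {F : Type*} [Field F] {ϑ : AddChar F ℂ}

theorem eq_of_forall_addChar_mul_eq (hϑ : ϑ ≠ 1) {a b : F} (h : ∀ t, ϑ (a * t) = ϑ (b * t)) :
    a = b := by
  by_contra hab
  obtain ⟨x, hx⟩ := AddChar.ne_one_iff.mp hϑ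
  have hab' : a - b ≠ 0 := sub_ne_zero.mpr hab
  apply hx
  -- The argument is scaled so that the two sides differ by `x`, where `ϑ x ≠ 1`.
  have h1 := h (x / (a - b))
  have h2 : a * (x / (a - b)) = b * (x / (a - b)) + x := by field_simp; ring
  rw [h2, AddChar.map_add_eq_mul] at h1
  exact (mul_right_eq_self₀.mp h1).resolve_right
    fun h0 => one_ne_zero (α := ℂ) (by
      rw [← AddChar.map_zero_eq_one ϑ, ← add_neg_cancel (b * (x / (a - b))),
        AddChar.map_add_eq_mul, h0, zero_mul])

theorem sum_addChar_mul_eq_zero [Fintype F] (hϑ : ϑ ≠ 1) {a : F} (ha : a ≠ 0) :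
    ∑ r, ϑ (a * r) = 0 := by
  classical
  have := AddChar.sum_mulShift a (AddChar.IsPrimitive.of_ne_one hϑ)
  simp only [mul_comm _ a] at this
  rw [this, if_neg ha, Nat.cast_zero]

end AdditiveCharacters

/-! ### The rows as characters induced from linear characters -/

section Rows

variable {F : Type*} [Field F]

/-- The subgroup from which a row of the table is induced. -/
noncomputable def Row.subgroup : Row F → Subgroup (U F)
  | .lin _ _ => ⊤
  | .chi3 _ => patternSubgroup F {r1, r3, r4, r5, r6}
  | .chi4 _ _ => patternSubgroup F {r2, r3, r4, r5, r6}
  | .chi5 _ _ _ => patternSubgroup F {r2, r3, r4, r5, r6}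
  | .chi6 _ _ => patternSubgroup F {r1, r4, r5, r6}

/-- The additive function whose composition with `ϑ` is the linear character from which a row of
the table is induced. -/
def Row.exponent : Row F → U F → F
  | .lin A12 A23, u => A12 * coord u r1 + A23 * coord u r2
  | .chi3 A13, u => -((A13 : F) * coord u r3)
  | .chi4 A15 A23, u => A23 * coord u r2 + 2 * (A15 : F) * coord u r4
  | .chi5 A16 A23 A13, u => A23 * coord u r2 + -(A13 * coord u r3) + (A16 : F) * coord u r5
  | .chi6 A17 A12, u => A12 * coord u r1 + (A17 : F) * coord u r6

variable (h2 : (2 : F) ≠ 0)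
include h2

theorem Row.exponent_one (i : Row F) : i.exponent 1 = 0 := by
  rw [← mk_zero h2]
  cases i <;> simp [Row.exponent, h2]

/-- The coordinates vanishing on the subgroup are those responsible for the nonlinear terms of the
group law in the coordinates that the exponent uses. -/
theorem Row.exponent_mul (i : Row F) {g h : U F} (hg : g ∈ i.subgroup) (hh : h ∈ i.subgroup) :
    i.exponent (g * h) = i.exponent g + i.exponent h := by
  obtain ⟨a1, a2, a3, a4, a5, a6, rfl⟩ := exists_mk h2 g
  obtain ⟨b1, b2, b3, b4, b5, b6, rfl⟩ := exists_mk h2 h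
  rw [mul_mk]
  cases i with
  | lin =>
    simp only [Row.exponent, mk_mul_y1 h2, mk_mul_y2 h2, mk_mul_y3 h2, mk_mul_y4 h2, mk_mul_y5 h2,
      mk_mul_y6 h2, coord_mk_r1 h2, coord_mk_r2 h2]
    ring
  | chi3 =>
    rw [Row.subgroup, mk_mem_pattern13456 h2] at hg hh
    simp only [Row.exponent, mk_mul_y1 h2, mk_mul_y2 h2, mk_mul_y3 h2, mk_mul_y4 h2, mk_mul_y5 h2,
      mk_mul_y6 h2, coord_mk_r3 h2, hg, hh]
    ring
  | chi4 =>
    rw [Row.subgroup, mk_mem_pattern23456 h2] at hg hh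
    simp only [Row.exponent, mk_mul_y1 h2, mk_mul_y2 h2, mk_mul_y3 h2, mk_mul_y4 h2, mk_mul_y5 h2,
      mk_mul_y6 h2, coord_mk_r2 h2, coord_mk_r4 h2, hg, hh]
    ring
  | chi5 =>
    rw [Row.subgroup, mk_mem_pattern23456 h2] at hg hh
    simp only [Row.exponent, mk_mul_y1 h2, mk_mul_y2 h2, mk_mul_y3 h2, mk_mul_y4 h2, mk_mul_y5 h2,
      mk_mul_y6 h2, coord_mk_r2 h2, coord_mk_r3 h2, coord_mk_r5 h2, hg, hh]
    ring
  | chi6 =>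
    rw [Row.subgroup, mk_mem_pattern1456 h2] at hg hh
    simp only [Row.exponent, mk_mul_y1 h2, mk_mul_y2 h2, mk_mul_y3 h2, mk_mul_y4 h2, mk_mul_y5 h2,
      mk_mul_y6 h2, coord_mk_r1 h2, coord_mk_r6 h2, hg.1, hg.2, hh.1, hh.2]
    ring

/-- The linear character from which a row of the table is induced. -/
noncomputable def Row.linear (ϑ : AddChar F ℂ) (i : Row F) : i.subgroup →* ℂ where
  toFun h := ϑ (i.exponent h)
  map_one' := by
    rw [Subgroup.coe_one, i.exponent_one h2, AddChar.map_zero_eq_one]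
  map_mul' g h := by
    rw [Subgroup.coe_mul, i.exponent_mul h2 g.2 h.2, AddChar.map_add_eq_mul]

theorem zeroExtend_linear (ϑ : AddChar F ℂ) (i : Row F) {g : U F} (hg : g ∈ i.subgroup) :
    zeroExtend (i.linear h2 ϑ) g = ϑ (i.exponent g) :=
  zeroExtend_of_mem _ hg

theorem Row.character_eq_induced [Fintype F] (ϑ : AddChar F ℂ) (i : Row F) :
    i.character ϑ = induced i.subgroup (i.linear h2 ϑ) := by
  cases i with
  | lin A12 A23 =>
    ext g
    -- The subgroup is the whole group, so `{1}` is a transversal.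
    refine Eq.trans ?_ (induced_eq_sum_transversal ((lin A12 A23).linear h2 ϑ)
      (fun _ : Unit => (1 : U F)) (fun g => ⟨(), Subgroup.mem_top _, fun _ _ => rfl⟩) g).symm
    simp only [Finset.univ_unique, Finset.sum_singleton, one_mul, inv_one, mul_one]
    rw [zeroExtend_linear h2 ϑ _ (Subgroup.mem_top g), Row.exponent, AddChar.map_add_eq_mul]
    simp only [Row.character]
  | chi3 A13 =>
    simp only [Row.character]
    refine congrArg (induced (patternSubgroup F _)) (funext fun h => ?_)
    change _ = ϑ ((chi3 A13).exponent h)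
    rw [Row.exponent]
  | chi4 A15 A23 =>
    simp only [Row.character]
    refine congrArg (induced (patternSubgroup F _)) (funext fun h => ?_)
    change _ = ϑ ((chi4 A15 A23).exponent h)
    rw [Row.exponent, AddChar.map_add_eq_mul]
  | chi5 A16 A23 A13 =>
    simp only [Row.character]
    refine congrArg (induced (patternSubgroup F _)) (funext fun h => ?_)
    change _ = ϑ ((chi5 A16 A23 A13).exponent h)
    rw [Row.exponent, AddChar.map_add_eq_mul, AddChar.map_add_eq_mul]
  | chi6 A17 A12 =>
    simp only [Row.character]
    refine congrArg (induced (patternSubgroup F _)) (funext fun h => ?_)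
    change _ = ϑ ((chi6 A17 A12).exponent h)
    rw [Row.exponent, AddChar.map_add_eq_mul]

end Rows

/-! ### Conjugates of root elements by an arbitrary element -/

section Orthogonality

variable {F : Type*} [Field F] (h2 : (2 : F) ≠ 0)

theorem conj_mk (g1 g2 g3 g4 g5 g6 b1 b2 b3 b4 b5 b6 : F) :
    mk g1 g2 g3 g4 g5 g6 * mk b1 b2 b3 b4 b5 b6 * (mk g1 g2 g3 g4 g5 g6)⁻¹ =
      y r2 g2 * (y r1 g1 * (y r3 g3 * (y r4 g4 * (y r5 g5 * (y r6 g6 * mk b1 b2 b3 b4 b5 b6 *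
        (y r6 g6)⁻¹) * (y r5 g5)⁻¹) * (y r4 g4)⁻¹) * (y r3 g3)⁻¹) * (y r1 g1)⁻¹) *
        (y r2 g2)⁻¹ := by
  rw [mk]
  group

include h2

theorem conj_mk_y6 (g1 g2 g3 g4 g5 g6 t : F) :
    mk g1 g2 g3 g4 g5 g6 * mk 0 0 0 0 0 t * (mk g1 g2 g3 g4 g5 g6)⁻¹ = mk 0 0 0 0 0 t := by
  rw [conj_mk, conj_y6 h2, conj_y5 h2, conj_y4 h2, conj_y3 h2, conj_y1 h2, conj_y2 h2]
  apply mk_congr <;> ring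

theorem conj_mk_y5 (g1 g2 g3 g4 g5 g6 t : F) :
    mk g1 g2 g3 g4 g5 g6 * mk 0 0 0 0 t 0 * (mk g1 g2 g3 g4 g5 g6)⁻¹ =
      mk 0 0 0 0 t (g2 * t) := by
  rw [conj_mk, conj_y6 h2, conj_y5 h2, conj_y4 h2, conj_y3 h2, conj_y1 h2, conj_y2 h2]
  apply mk_congr <;> ring

theorem conj_mk_y4 (g1 g2 g3 g4 g5 g6 t : F) :
    mk g1 g2 g3 g4 g5 g6 * mk 0 0 0 t 0 0 * (mk g1 g2 g3 g4 g5 g6)⁻¹ =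
      mk 0 0 0 t (3 * g1 * t) (3 * (g3 + g1 * g2) * t) := by
  rw [conj_mk, conj_y6 h2, conj_y5 h2, conj_y4 h2, conj_y3 h2, conj_y1 h2, conj_y2 h2]
  apply mk_congr <;> ring

/-- The coordinates left unspecified, here and in the next two lemmas, do not enter the exponents
tested on these elements. -/
theorem conj_mk_y3 (g1 g2 g3 g4 g5 g6 t : F) : ∃ c5 c6,
    mk g1 g2 g3 g4 g5 g6 * mk 0 0 t 0 0 0 * (mk g1 g2 g3 g4 g5 g6)⁻¹ =
      mk 0 0 t (2 * g1 * t) c5 c6 ∧ (g1 = 0 → c5 = 0) := by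
  rw [conj_mk, conj_y6 h2, conj_y5 h2, conj_y4 h2, conj_y3 h2, conj_y1 h2, conj_y2 h2]
  refine ⟨_, _, mk_congr (by ring) (by ring) (by ring) (by ring) rfl rfl, ?_⟩
  rintro rfl
  ring

theorem conj_mk_y2 (g1 g2 g3 g4 g5 g6 t : F) : ∃ c3 c4 c5 c6,
    mk g1 g2 g3 g4 g5 g6 * mk 0 t 0 0 0 0 * (mk g1 g2 g3 g4 g5 g6)⁻¹ =
      mk 0 t c3 c4 c5 c6 ∧ (g1 = 0 → c3 = 0 ∧ c4 = 0 ∧ c5 = 0) := by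
  rw [conj_mk, conj_y6 h2, conj_y5 h2, conj_y4 h2, conj_y3 h2, conj_y1 h2, conj_y2 h2]
  refine ⟨_, _, _, _, mk_congr (by ring) (by ring) rfl rfl rfl rfl, ?_⟩
  rintro rfl
  exact ⟨by ring, by ring, by ring⟩

theorem conj_mk_y1 (g1 g2 g3 g4 g5 g6 t : F) : ∃ c4 c5 c6,
    mk g1 g2 g3 g4 g5 g6 * mk t 0 0 0 0 0 * (mk g1 g2 g3 g4 g5 g6)⁻¹ =
      mk t 0 (g2 * t) c4 c5 c6 := by
  rw [conj_mk, conj_y6 h2, conj_y5 h2, conj_y4 h2, conj_y3 h2, conj_y1 h2, conj_y2 h2]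
  exact ⟨_, _, _, mk_congr (by ring) (by ring) (by ring) rfl rfl rfl⟩

end Orthogonality

/-! ### Linked rows coincide -/

section Orthogonality

variable {F : Type*} [Field F] {ϑ : AddChar F ℂ}

/-- The root (numbered `0` for linear characters) on which the row of the table is faithful. -/
def Row.depth : Row F → ℕ
  | .lin _ _ => 0
  | .chi3 _ => 3
  | .chi4 _ _ => 4
  | .chi5 _ _ _ => 5
  | .chi6 _ _ => 6

/-- The linear characters that induce the rows `i` and `j` agree on the intersection of the first
subgroup with the conjugate by `g` of the second one. -/
def Row.Linked (ϑ : AddChar F ℂ) (i j : Row F) (g : U F) : Prop :=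
  ∀ h ∈ i.subgroup, g * h * g⁻¹ ∈ j.subgroup → ϑ (i.exponent h) = ϑ (j.exponent (g * h * g⁻¹))

/-- The basic test: along a one-parameter family on which both exponents are linear, a link forces
equal slopes. -/
theorem Row.Linked.coeff_eq (hϑ : ϑ ≠ 1) {i j : Row F} {g : U F} (H : i.Linked ϑ j g)
    (x : F → U F) {a b : F} (hx : ∀ t, x t ∈ i.subgroup ∧ i.exponent (x t) = a * t)
    (hz : ∀ t, ∃ z, g * x t * g⁻¹ = z ∧ z ∈ j.subgroup ∧ j.exponent z = b * t) : a = b := by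
  refine eq_of_forall_addChar_mul_eq hϑ fun t => ?_
  obtain ⟨z, rfl, hz1, hz2⟩ := hz t
  rw [← (hx t).2, ← hz2]
  exact H _ (hx t).1 hz1

variable (h2 : (2 : F) ≠ 0)
include h2

/-- The central elements `y r6 t` determine the type and `A17`. Testing on `y r5 t` and `y r4 t`
gives `g2 = 0` and `g3 + g1 * g2 = 0`, so `g` lies in the subgroup; `y r1 t` then determines `A12`.
-/
theorem Row.Linked.eq_of_chi6 (hϑ : ϑ ≠ 1) (h3 : (3 : F) ≠ 0) {A17 : Fˣ} {A12 : F} {j : Row F}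
    {g : U F} (H : (Row.chi6 A17 A12).Linked ϑ j g) :
    Row.chi6 A17 A12 = j ∧ g ∈ (Row.chi6 A17 A12).subgroup := by
  obtain ⟨g1, g2, g3, g4, g5, g6, rfl⟩ := exists_mk h2 g
  have h6 : ∀ b : F, (∀ t, mk 0 0 0 0 0 t ∈ j.subgroup ∧ j.exponent (mk 0 0 0 0 0 t) = b * t) →
      (A17 : F) = b := fun b hb =>
    H.coeff_eq hϑ (fun t => mk 0 0 0 0 0 t)
      (fun t => by simp [Row.subgroup, Row.exponent, mk_mem_pattern1456, h2])
      fun t => ⟨_, conj_mk_y6 h2 .., hb t⟩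
  cases j with
  | lin => exact absurd (h6 0 fun t => by simp [Row.subgroup, Row.exponent, h2]) A17.ne_zero
  | chi3 =>
    exact absurd (h6 0 fun t => by
      simp [Row.subgroup, Row.exponent, mk_mem_pattern13456, h2]) A17.ne_zero
  | chi4 =>
    exact absurd (h6 0 fun t => by
      simp [Row.subgroup, Row.exponent, mk_mem_pattern23456, h2]) A17.ne_zero
  | chi5 =>
    exact absurd (h6 0 fun t => by
      simp [Row.subgroup, Row.exponent, mk_mem_pattern23456, h2]) A17.ne_zero
  | chi6 B17 B12 =>
    have e1 : (A17 : F) = B17 := h6 _ fun t => by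
      simp [Row.subgroup, Row.exponent, mk_mem_pattern1456, h2]
    have e2 : 0 = (B17 : F) * g2 := H.coeff_eq hϑ (fun t => mk 0 0 0 0 t 0)
      (fun t => by simp [Row.subgroup, Row.exponent, mk_mem_pattern1456, h2])
      fun t => ⟨_, conj_mk_y5 h2 .., by
        simp [Row.subgroup, Row.exponent, mk_mem_pattern1456, h2, mul_assoc]⟩
    have e3 : 0 = (B17 : F) * (3 * (g3 + g1 * g2)) := H.coeff_eq hϑ (fun t => mk 0 0 0 t 0 0)
      (fun t => by simp [Row.subgroup, Row.exponent, mk_mem_pattern1456, h2])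
      fun t => ⟨_, conj_mk_y4 h2 .., by
        simp [Row.subgroup, Row.exponent, mk_mem_pattern1456, h2, mul_assoc]⟩
    have hg2 : g2 = 0 := (mul_eq_zero.mp e2.symm).resolve_left B17.ne_zero
    subst hg2
    have hg3 : g3 = 0 := by
      have := (mul_eq_zero.mp ((mul_eq_zero.mp e3.symm).resolve_left B17.ne_zero)).resolve_left h3
      simpa using this
    subst hg3
    have hg : mk g1 0 0 g4 g5 g6 ∈ (Row.chi6 B17 B12).subgroup := by
      simp [Row.subgroup, mk_mem_pattern1456, h2]
    have e4 : A12 = B12 := H.coeff_eq hϑ (fun t => mk t 0 0 0 0 0)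
      (fun t => by simp [Row.subgroup, Row.exponent, mk_mem_pattern1456, h2])
      fun t => by
        have ht : mk t 0 0 0 0 0 ∈ (Row.chi6 B17 B12).subgroup := by
          simp [Row.subgroup, mk_mem_pattern1456, h2]
        refine ⟨_, rfl, mul_mem (mul_mem hg ht) (inv_mem hg), ?_⟩
        -- Since `g` is now in the subgroup, additivity makes the exponent invariant under
        -- conjugation by `g`.
        have hc := (Row.chi6 B17 B12).exponent_mul h2 hg (inv_mem hg)
        rw [mul_inv_cancel, Row.exponent_one h2] at hc
        rw [Row.exponent_mul h2 _ (mul_mem hg ht) (inv_mem hg), Row.exponent_mul h2 _ hg ht,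
          add_right_comm, ← hc]
        simp [Row.exponent, h2]
    exact ⟨by rw [Units.ext e1, e4], hg⟩

/-- Here `y r5 t` determines the type and `A16`, `y r4 t` gives `g1 = 0`, and then `y r3 t` and `y
r2 t` give `A13` and `A23`. The depth bound excludes `chi6`, which is not trivial on the sixth
coordinate produced by conjugation. -/
theorem Row.Linked.eq_of_chi5 (hϑ : ϑ ≠ 1) (h3 : (3 : F) ≠ 0) {A16 : Fˣ} {A23 A13 : F} {j : Row F}
    {g : U F} (hj : j.depth ≤ 5) (H : (Row.chi5 A16 A23 A13).Linked ϑ j g) :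
    Row.chi5 A16 A23 A13 = j ∧ g ∈ (Row.chi5 A16 A23 A13).subgroup := by
  obtain ⟨g1, g2, g3, g4, g5, g6, rfl⟩ := exists_mk h2 g
  have h5 : ∀ b : F, (∀ t c, mk 0 0 0 0 t c ∈ j.subgroup ∧
      j.exponent (mk 0 0 0 0 t c) = b * t) → (A16 : F) = b := fun b hb =>
    H.coeff_eq hϑ (fun t => mk 0 0 0 0 t 0)
      (fun t => by simp [Row.subgroup, Row.exponent, mk_mem_pattern23456, h2])
      fun t => ⟨_, conj_mk_y5 h2 .., hb t _⟩
  cases j with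
  | lin => exact absurd (h5 0 fun t c => by simp [Row.subgroup, Row.exponent, h2]) A16.ne_zero
  | chi3 =>
    exact absurd (h5 0 fun t c => by
      simp [Row.subgroup, Row.exponent, mk_mem_pattern13456, h2]) A16.ne_zero
  | chi4 =>
    exact absurd (h5 0 fun t c => by
      simp [Row.subgroup, Row.exponent, mk_mem_pattern23456, h2]) A16.ne_zero
  | chi6 => exact absurd hj (by simp [Row.depth])
  | chi5 B16 B23 B13 =>
    have e1 : (A16 : F) = B16 := h5 _ fun t c => by
      simp [Row.subgroup, Row.exponent, mk_mem_pattern23456, h2]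
    have e2 : 0 = (B16 : F) * (3 * g1) := H.coeff_eq hϑ (fun t => mk 0 0 0 t 0 0)
      (fun t => by simp [Row.subgroup, Row.exponent, mk_mem_pattern23456, h2])
      fun t => ⟨_, conj_mk_y4 h2 .., by
        simp [Row.subgroup, Row.exponent, mk_mem_pattern23456, h2, mul_assoc]⟩
    have hg1 : g1 = 0 :=
      (mul_eq_zero.mp ((mul_eq_zero.mp e2.symm).resolve_left B16.ne_zero)).resolve_left h3
    subst hg1
    have e3 : -A13 = -B13 := H.coeff_eq hϑ (fun t => mk 0 0 t 0 0 0)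
      (fun t => by simp [Row.subgroup, Row.exponent, mk_mem_pattern23456, h2])
      fun t => by
        obtain ⟨c5, c6, hc, hc5⟩ := conj_mk_y3 h2 0 g2 g3 g4 g5 g6 t
        exact ⟨_, hc, by
          simp [Row.subgroup, Row.exponent, mk_mem_pattern23456, h2, hc5 rfl]⟩
    have e4 : A23 = B23 := H.coeff_eq hϑ (fun t => mk 0 t 0 0 0 0)
      (fun t => by simp [Row.subgroup, Row.exponent, mk_mem_pattern23456, h2])
      fun t => by
        obtain ⟨c3, c4, c5, c6, hc, hc5⟩ := conj_mk_y2 h2 0 g2 g3 g4 g5 g6 t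
        obtain ⟨rfl, rfl, rfl⟩ := hc5 rfl
        exact ⟨_, hc, by simp [Row.subgroup, Row.exponent, mk_mem_pattern23456, h2]⟩
    exact ⟨by rw [Units.ext e1, e4, neg_inj.mp e3], by
      simp [Row.subgroup, mk_mem_pattern23456, h2]⟩

/-- Same scheme: `y r4 t` for the type and `A15`, `y r3 t` for `g1 = 0`, `y r2 t` for `A23`. -/
theorem Row.Linked.eq_of_chi4 (hϑ : ϑ ≠ 1) {A15 : Fˣ} {A23 : F} {j : Row F}
    {g : U F} (hj : j.depth ≤ 4) (H : (Row.chi4 A15 A23).Linked ϑ j g) :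
    Row.chi4 A15 A23 = j ∧ g ∈ (Row.chi4 A15 A23).subgroup := by
  obtain ⟨g1, g2, g3, g4, g5, g6, rfl⟩ := exists_mk h2 g
  have h4 : ∀ b : F, (∀ t c d, mk 0 0 0 t c d ∈ j.subgroup ∧
      j.exponent (mk 0 0 0 t c d) = b * t) → 2 * (A15 : F) = b := fun b hb =>
    H.coeff_eq hϑ (fun t => mk 0 0 0 t 0 0)
      (fun t => by simp [Row.subgroup, Row.exponent, mk_mem_pattern23456, h2])
      fun t => ⟨_, conj_mk_y4 h2 .., hb t _ _⟩
  cases j with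
  | lin =>
    exact absurd (h4 0 fun t c d => by simp [Row.subgroup, Row.exponent, h2])
      (mul_ne_zero h2 A15.ne_zero)
  | chi3 =>
    exact absurd (h4 0 fun t c d => by
      simp [Row.subgroup, Row.exponent, mk_mem_pattern13456, h2]) (mul_ne_zero h2 A15.ne_zero)
  | chi5 => exact absurd hj (by simp [Row.depth])
  | chi6 => exact absurd hj (by simp [Row.depth])
  | chi4 B15 B23 =>
    have e1 : 2 * (A15 : F) = 2 * B15 := h4 _ fun t c d => by
      simp [Row.subgroup, Row.exponent, mk_mem_pattern23456, h2]
    have e2 : 0 = 2 * (B15 : F) * (2 * g1) := H.coeff_eq hϑ (fun t => mk 0 0 t 0 0 0)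
      (fun t => by simp [Row.subgroup, Row.exponent, mk_mem_pattern23456, h2])
      fun t => by
        obtain ⟨c5, c6, hc, -⟩ := conj_mk_y3 h2 g1 g2 g3 g4 g5 g6 t
        exact ⟨_, hc, by
          simp [Row.subgroup, Row.exponent, mk_mem_pattern23456, h2, mul_assoc]⟩
    have hg1 : g1 = 0 := (mul_eq_zero.mp ((mul_eq_zero.mp e2.symm).resolve_left
      (mul_ne_zero h2 B15.ne_zero))).resolve_left h2
    subst hg1
    have e4 : A23 = B23 := H.coeff_eq hϑ (fun t => mk 0 t 0 0 0 0)
      (fun t => by simp [Row.subgroup, Row.exponent, mk_mem_pattern23456, h2])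
      fun t => by
        obtain ⟨c3, c4, c5, c6, hc, hc5⟩ := conj_mk_y2 h2 0 g2 g3 g4 g5 g6 t
        obtain ⟨rfl, rfl, rfl⟩ := hc5 rfl
        exact ⟨_, hc, by simp [Row.subgroup, Row.exponent, mk_mem_pattern23456, h2]⟩
    exact ⟨by rw [Units.ext (mul_left_cancel₀ h2 e1), e4], by
      simp [Row.subgroup, mk_mem_pattern23456, h2]⟩

/-- Same scheme: `y r3 t` for the type and `A13`, then `y r1 t`, whose conjugate has third
coordinate `g2 * t`, for `g2 = 0`. -/
theorem Row.Linked.eq_of_chi3 (hϑ : ϑ ≠ 1) {A13 : Fˣ} {j : Row F}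
    {g : U F} (hj : j.depth ≤ 3) (H : (Row.chi3 A13).Linked ϑ j g) :
    Row.chi3 A13 = j ∧ g ∈ (Row.chi3 A13).subgroup := by
  obtain ⟨g1, g2, g3, g4, g5, g6, rfl⟩ := exists_mk h2 g
  have h_3 : ∀ b : F, (∀ t c d e, mk 0 0 t c d e ∈ j.subgroup ∧
      j.exponent (mk 0 0 t c d e) = b * t) → -(A13 : F) = b := fun b hb =>
    H.coeff_eq hϑ (fun t => mk 0 0 t 0 0 0)
      (fun t => by simp [Row.subgroup, Row.exponent, mk_mem_pattern13456, h2])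
      fun t => by
        obtain ⟨c5, c6, hc, -⟩ := conj_mk_y3 h2 g1 g2 g3 g4 g5 g6 t
        exact ⟨_, hc, hb t _ _ _⟩
  cases j with
  | lin =>
    exact absurd (h_3 0 fun t c d e => by simp [Row.subgroup, Row.exponent, h2])
      (neg_ne_zero.mpr A13.ne_zero)
  | chi4 => exact absurd hj (by simp [Row.depth])
  | chi5 => exact absurd hj (by simp [Row.depth])
  | chi6 => exact absurd hj (by simp [Row.depth])
  | chi3 B13 =>
    have e1 : -(A13 : F) = -B13 := h_3 _ fun t c d e => by
      simp [Row.subgroup, Row.exponent, mk_mem_pattern13456, h2]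
    have e2 : 0 = -(B13 : F) * g2 := H.coeff_eq hϑ (fun t => mk t 0 0 0 0 0)
      (fun t => by simp [Row.subgroup, Row.exponent, mk_mem_pattern13456, h2])
      fun t => by
        obtain ⟨c4, c5, c6, hc⟩ := conj_mk_y1 h2 g1 g2 g3 g4 g5 g6 t
        exact ⟨_, hc, by
          simp [Row.subgroup, Row.exponent, mk_mem_pattern13456, h2, mul_assoc]⟩
    have hg2 : g2 = 0 := (mul_eq_zero.mp e2.symm).resolve_left (neg_ne_zero.mpr B13.ne_zero)
    exact ⟨by rw [Units.ext (neg_inj.mp e1)], by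
      simp [Row.subgroup, mk_mem_pattern13456, h2, hg2]⟩

theorem Row.Linked.eq_of_lin (hϑ : ϑ ≠ 1) {A12 A23 : F} {j : Row F}
    {g : U F} (hj : j.depth ≤ 0) (H : (Row.lin A12 A23).Linked ϑ j g) :
    Row.lin A12 A23 = j ∧ g ∈ (Row.lin A12 A23).subgroup := by
  refine ⟨?_, Subgroup.mem_top g⟩
  obtain ⟨g1, g2, g3, g4, g5, g6, rfl⟩ := exists_mk h2 g
  cases j with
  | chi3 => exact absurd hj (by simp [Row.depth])
  | chi4 => exact absurd hj (by simp [Row.depth])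
  | chi5 => exact absurd hj (by simp [Row.depth])
  | chi6 => exact absurd hj (by simp [Row.depth])
  | lin B12 B23 =>
    have e1 : A12 = B12 := H.coeff_eq hϑ (fun t => mk t 0 0 0 0 0)
      (fun t => by simp [Row.subgroup, Row.exponent, h2])
      fun t => by
        obtain ⟨c4, c5, c6, hc⟩ := conj_mk_y1 h2 g1 g2 g3 g4 g5 g6 t
        exact ⟨_, hc, by simp [Row.subgroup, Row.exponent, h2]⟩
    have e2 : A23 = B23 := H.coeff_eq hϑ (fun t => mk 0 t 0 0 0 0)
      (fun t => by simp [Row.subgroup, Row.exponent, h2])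
      fun t => by
        obtain ⟨c3, c4, c5, c6, hc, -⟩ := conj_mk_y2 h2 g1 g2 g3 g4 g5 g6 t
        exact ⟨_, hc, by simp [Row.subgroup, Row.exponent, h2]⟩
    rw [e1, e2]

theorem Row.Linked.eq_and_mem (hϑ : ϑ ≠ 1) (h3 : (3 : F) ≠ 0) {i j : Row F} {g : U F}
    (hij : j.depth ≤ i.depth) (H : i.Linked ϑ j g) : i = j ∧ g ∈ i.subgroup := by
  cases i with
  | lin => exact Row.Linked.eq_of_lin h2 hϑ hij H
  | chi3 => exact Row.Linked.eq_of_chi3 h2 hϑ hij H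
  | chi4 => exact Row.Linked.eq_of_chi4 h2 hϑ hij H
  | chi5 => exact Row.Linked.eq_of_chi5 h2 hϑ h3 hij H
  | chi6 => exact Row.Linked.eq_of_chi6 h2 hϑ h3 H

theorem Row.exists_ne_of_not_linked {i j : Row F} {g : U F} (H : ¬ i.Linked ϑ j g) :
    ∃ h ∈ i.subgroup, g * h * g⁻¹ ∈ j.subgroup ∧
      zeroExtend (i.linear h2 ϑ) h ≠ zeroExtend (j.linear h2 ϑ) (g * h * g⁻¹) := by
  simp only [Row.Linked, not_forall] at H
  obtain ⟨h, hi, hj, hne⟩ := H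
  exact ⟨h, hi, hj, by rwa [zeroExtend_linear h2 ϑ i hi, zeroExtend_linear h2 ϑ j hj]⟩

variable [Fintype F]

theorem characterInner_character_self (hϑ : ϑ ≠ 1) (h3 : (3 : F) ≠ 0) (i : Row F) :
    characterInner (i.character ϑ) (i.character ϑ) = 1 := by
  rw [i.character_eq_induced h2]
  refine characterInner_induced_self _ fun g hg => Row.exists_ne_of_not_linked h2 fun H => ?_
  exact hg (Row.Linked.eq_and_mem h2 hϑ h3 le_rfl H).2

theorem characterInner_character_of_ne (hϑ : ϑ ≠ 1) (h3 : (3 : F) ≠ 0) {i j : Row F}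
    (hij : i ≠ j) : characterInner (i.character ϑ) (j.character ϑ) = 0 := by
  -- The inner product is Hermitian, so the deeper row may be taken first.
  wlog hd : j.depth ≤ i.depth generalizing i j
  · have := congrArg (starRingEnd ℂ) (this hij.symm (le_of_not_ge hd))
    rw [map_zero] at this
    rw [← this]
    simp [characterInner, mul_comm]
  rw [i.character_eq_induced h2, j.character_eq_induced h2]
  exact characterInner_induced_eq_zero _ _ fun g => Row.exists_ne_of_not_linked h2 fun H =>
    hij (Row.Linked.eq_and_mem h2 hϑ h3 hd H).1

theorem isIrreducibleCharacter_character (hϑ : ϑ ≠ 1) (h3 : (3 : F) ≠ 0) (i : Row F) :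
    IsIrreducibleCharacter (i.character ϑ) := by
  have := characterInner_character_self h2 hϑ h3 i
  rw [i.character_eq_induced h2] at this ⊢
  exact isIrreducibleCharacter_induced _ this

theorem character_injective (hϑ : ϑ ≠ 1) (h3 : (3 : F) ≠ 0) :
    Function.Injective fun i : Row F => i.character ϑ := by
  intro i j hij
  by_contra hne
  have h0 := characterInner_character_of_ne h2 hϑ h3 hne
  dsimp only at hij
  rw [← hij, characterInner_character_self h2 hϑ h3] at h0
  exact one_ne_zero h0

end Orthogonality

/-! ### The entries of the table -/

section Values

variable {F : Type*} [Field F] (h2 : (2 : F) ≠ 0)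
include h2

theorem existsUnique_transversal13456 (g : U F) :
    ∃! s : F, g * (y r2 s)⁻¹ ∈ patternSubgroup F {r1, r3, r4, r5, r6} := by
  obtain ⟨a1, a2, a3, a4, a5, a6, rfl⟩ := exists_mk h2 g
  simp only [inv_y h2, mk_mul_y2 h2, mk_mem_pattern13456 h2]
  exact ⟨a2, add_neg_cancel a2, fun s hs => by linear_combination -hs⟩

theorem existsUnique_transversal23456 (g : U F) :
    ∃! s : F, g * (y r1 s)⁻¹ ∈ patternSubgroup F {r2, r3, r4, r5, r6} := by
  obtain ⟨a1, a2, a3, a4, a5, a6, rfl⟩ := exists_mk h2 g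
  simp only [inv_y h2, mk_mul_y1 h2, mk_mem_pattern23456 h2]
  exact ⟨a1, add_neg_cancel a1, fun s hs => by linear_combination -hs⟩

theorem existsUnique_transversal1456 (g : U F) :
    ∃! x : F × F, g * (y r2 x.1 * y r3 x.2)⁻¹ ∈ patternSubgroup F {r1, r4, r5, r6} := by
  obtain ⟨a1, a2, a3, a4, a5, a6, rfl⟩ := exists_mk h2 g
  simp only [mul_inv_rev, ← mul_assoc, inv_y h2, mk_mul_y2 h2, mk_mul_y3 h2,
    mk_mem_pattern1456 h2]
  -- The second coordinate forces `s = a2`; the third, `a3 - r + a1 * s`, then forces the value of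
  -- `r`.
  refine ⟨(a2, a3 + a1 * a2), ⟨by ring, by ring⟩, ?_⟩
  rintro ⟨s, r⟩ ⟨hs, hr⟩
  dsimp only at hs hr
  have hs' : s = a2 := by linear_combination -hs
  subst hs'
  exact Prod.ext rfl (by linear_combination -hr)

variable [Fintype F] (ϑ : AddChar F ℂ)

theorem Row.character_eq_sum_transversal (i : Row F) {ι : Type*} [Fintype ι] (T : ι → U F)
    (hT : ∀ g : U F, ∃! k, g * (T k)⁻¹ ∈ i.subgroup) (x : U F) :
    i.character ϑ x = ∑ k, zeroExtend (i.linear h2 ϑ) (T k * x * (T k)⁻¹) := by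
  rw [i.character_eq_induced h2, induced_eq_sum_transversal _ T hT]

/-- Conjugation by `y r2 s` keeps the second coordinate, so either all terms of the transversal sum
lie in the subgroup, as here, or none do, as in the next lemma. -/
theorem chi3_apply (A13 : Fˣ) (a1 a3 a4 a5 a6 : F) :
    (Row.chi3 A13).character ϑ (mk a1 0 a3 a4 a5 a6) =
      ∑ s, ϑ (-((A13 : F) * (a3 + a1 * s))) := by
  rw [Row.character_eq_sum_transversal h2 ϑ (Row.chi3 A13) _
    (existsUnique_transversal13456 h2)]
  refine Finset.sum_congr rfl fun s _ => ?_
  rw [conj_y2 h2, zeroExtend_linear h2 ϑ _ ((mk_mem_pattern13456 h2 ..).mpr rfl), Row.exponent,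
    coord_mk_r3 h2]

theorem chi3_apply_eq_zero (A13 : Fˣ) {a2 : F} (h : a2 ≠ 0) (a1 a3 a4 a5 a6 : F) :
    (Row.chi3 A13).character ϑ (mk a1 a2 a3 a4 a5 a6) = 0 := by
  rw [Row.character_eq_sum_transversal h2 ϑ (Row.chi3 A13) _
    (existsUnique_transversal13456 h2)]
  refine Finset.sum_eq_zero fun s _ => ?_
  rw [conj_y2 h2]
  exact zeroExtend_of_notMem _ fun H => h ((mk_mem_pattern13456 h2 ..).mp H)

theorem chi4_apply (A15 : Fˣ) (A23 a2 a3 a4 a5 a6 : F) :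
    (Row.chi4 A15 A23).character ϑ (mk 0 a2 a3 a4 a5 a6) =
      ∑ s, ϑ (A23 * a2 + 2 * A15 * (a4 + 2 * a3 * s - a2 * s ^ 2)) := by
  rw [Row.character_eq_sum_transversal h2 ϑ (Row.chi4 A15 A23) _
    (existsUnique_transversal23456 h2)]
  refine Finset.sum_congr rfl fun s _ => ?_
  rw [conj_y1 h2, zeroExtend_linear h2 ϑ _ ((mk_mem_pattern23456 h2 ..).mpr rfl), Row.exponent,
    coord_mk_r2 h2, coord_mk_r4 h2]
  congr 1
  ring

theorem chi4_apply_eq_zero (A15 : Fˣ) {a1 : F} (h : a1 ≠ 0) (A23 a2 a3 a4 a5 a6 : F) :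
    (Row.chi4 A15 A23).character ϑ (mk a1 a2 a3 a4 a5 a6) = 0 := by
  rw [Row.character_eq_sum_transversal h2 ϑ (Row.chi4 A15 A23) _
    (existsUnique_transversal23456 h2)]
  refine Finset.sum_eq_zero fun s _ => ?_
  rw [conj_y1 h2]
  exact zeroExtend_of_notMem _ fun H => h ((mk_mem_pattern23456 h2 ..).mp H)

theorem chi5_apply (A16 : Fˣ) (A23 A13 a2 a3 a4 a5 a6 : F) :
    (Row.chi5 A16 A23 A13).character ϑ (mk 0 a2 a3 a4 a5 a6) =
      ∑ s, ϑ (A23 * a2 - A13 * (a3 - a2 * s) +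
        A16 * (a5 + 3 * a4 * s + 3 * a3 * s ^ 2 - a2 * s ^ 3)) := by
  rw [Row.character_eq_sum_transversal h2 ϑ (Row.chi5 A16 A23 A13) _
    (existsUnique_transversal23456 h2)]
  refine Finset.sum_congr rfl fun s _ => ?_
  rw [conj_y1 h2, zeroExtend_linear h2 ϑ _ ((mk_mem_pattern23456 h2 ..).mpr rfl), Row.exponent,
    coord_mk_r2 h2, coord_mk_r3 h2, coord_mk_r5 h2]
  congr 1
  ring

theorem chi5_apply_eq_zero (A16 : Fˣ) {a1 : F} (h : a1 ≠ 0) (A23 A13 a2 a3 a4 a5 a6 : F) :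
    (Row.chi5 A16 A23 A13).character ϑ (mk a1 a2 a3 a4 a5 a6) = 0 := by
  rw [Row.character_eq_sum_transversal h2 ϑ (Row.chi5 A16 A23 A13) _
    (existsUnique_transversal23456 h2)]
  refine Finset.sum_eq_zero fun s _ => ?_
  rw [conj_y1 h2]
  exact zeroExtend_of_notMem _ fun H => h ((mk_mem_pattern23456 h2 ..).mp H)

omit h2 [Fintype F] in
theorem conj_y2_mul_y3 (s r : F) (g : U F) : y r2 s * y r3 r * g * (y r2 s * y r3 r)⁻¹ =
    y r2 s * (y r3 r * g * (y r3 r)⁻¹) * (y r2 s)⁻¹ := by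
  simp only [mul_inv_rev, mul_assoc]

theorem chi6_apply (A17 : Fˣ) (A12 a4 a5 a6 : F) :
    (Row.chi6 A17 A12).character ϑ (mk 0 0 0 a4 a5 a6) =
      ∑ s, ∑ r, ϑ (A17 * (a6 + 3 * a4 * r + a5 * s)) := by
  rw [Row.character_eq_sum_transversal h2 ϑ (Row.chi6 A17 A12) _
    (existsUnique_transversal1456 h2),
    Fintype.sum_prod_type]
  refine Finset.sum_congr rfl fun s _ => Finset.sum_congr rfl fun r _ => ?_
  rw [conj_y2_mul_y3, conj_y3 h2, conj_y2 h2,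
    zeroExtend_linear h2 ϑ _ ((mk_mem_pattern1456 h2 ..).mpr ⟨rfl, by ring⟩), Row.exponent,
    coord_mk_r1 h2, coord_mk_r6 h2]
  congr 1
  ring

/-- Conjugation by `y r2 s` creates the third coordinate `a1 * s`, so only `s = 0` stays in the
subgroup. -/
theorem chi6_apply_of_r1_ne_zero (A17 : Fˣ) {a1 : F} (h : a1 ≠ 0) (A12 a4 a5 a6 : F) :
    (Row.chi6 A17 A12).character ϑ (mk a1 0 0 a4 a5 a6) =
      ∑ r, ϑ (A12 * a1 + A17 * (a6 + 3 * a4 * r - 3 * a1 * r ^ 2)) := by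
  rw [Row.character_eq_sum_transversal h2 ϑ (Row.chi6 A17 A12) _
    (existsUnique_transversal1456 h2),
    Fintype.sum_prod_type, Finset.sum_eq_single 0]
  · refine Finset.sum_congr rfl fun r _ => ?_
    rw [conj_y2_mul_y3, conj_y3 h2, conj_y2 h2,
      zeroExtend_linear h2 ϑ _ ((mk_mem_pattern1456 h2 ..).mpr ⟨rfl, by ring⟩), Row.exponent,
      coord_mk_r1 h2, coord_mk_r6 h2]
    congr 1
    ring
  · intro s _ hs
    refine Finset.sum_eq_zero fun r _ => ?_
    rw [conj_y2_mul_y3, conj_y3 h2, conj_y2 h2, zeroExtend_of_notMem]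
    intro H
    have := ((mk_mem_pattern1456 h2 ..).mp H).2
    rw [zero_add] at this
    exact mul_ne_zero h hs this
  · simp

theorem chi6_apply_eq_zero_of_r2_ne_zero (A17 : Fˣ) {a2 : F} (h : a2 ≠ 0) (A12 a1 a3 a4 a5 a6 : F) :
    (Row.chi6 A17 A12).character ϑ (mk a1 a2 a3 a4 a5 a6) = 0 := by
  rw [Row.character_eq_sum_transversal h2 ϑ (Row.chi6 A17 A12) _
    (existsUnique_transversal1456 h2)]
  refine Finset.sum_eq_zero fun x _ => ?_
  rw [conj_y2_mul_y3, conj_y3 h2, conj_y2 h2]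
  exact zeroExtend_of_notMem _ fun H => h ((mk_mem_pattern1456 h2 ..).mp H).1

theorem chi6_apply_eq_zero_of_r3_ne_zero (A17 : Fˣ) {a3 : F} (h : a3 ≠ 0) (A12 a4 a5 a6 : F) :
    (Row.chi6 A17 A12).character ϑ (mk 0 0 a3 a4 a5 a6) = 0 := by
  rw [Row.character_eq_sum_transversal h2 ϑ (Row.chi6 A17 A12) _
    (existsUnique_transversal1456 h2)]
  refine Finset.sum_eq_zero fun x _ => ?_
  rw [conj_y2_mul_y3, conj_y3 h2, conj_y2 h2, zeroExtend_of_notMem]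
  intro H
  have := ((mk_mem_pattern1456 h2 ..).mp H).2
  rw [zero_mul, add_zero] at this
  exact h this

theorem lin_apply_representative (A12 A23 : F) (c : Column F) :
    (Row.lin A12 A23).character ϑ c.representative = tableEntry ϑ (.lin A12 A23) c := by
  cases c with
  | one =>
    rw [Column.representative, ← mk_zero h2]
    simp [Row.character, tableEntry, h2]
  | y1y6 => rw [representative_y1y6]; simp [Row.character, tableEntry, h2]
  | y2y4y5 => rw [representative_y2y4y5]; simp [Row.character, tableEntry, h2]
  | y2y1 => rw [representative_y2y1]; simp [Row.character, tableEntry, h2]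
  | y3y5 => rw [representative_y3y5]; simp [Row.character, tableEntry, h2]
  | y4 => rw [representative_y4]; simp [Row.character, tableEntry, h2]
  | y5 => rw [representative_y5]; simp [Row.character, tableEntry, h2]
  | y6 => rw [representative_y6]; simp [Row.character, tableEntry, h2]

variable {ϑ} (hϑ : ϑ ≠ 1)
include hϑ

theorem chi3_apply_representative (A13 : Fˣ) (c : Column F) :
    (Row.chi3 A13).character ϑ c.representative = tableEntry ϑ (.chi3 A13) c := by
  cases c with
  | one =>
    rw [Column.representative, ← mk_zero h2, chi3_apply h2]
    simp [tableEntry]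
  | y1y6 t1 t6 =>
    -- The zero of the table is rewritten as a full sum of the nontrivial character `s ↦ ϑ (-A13 *
    -- t1 * s)`; the other vanishing sums are treated alike.
    rw [representative_y1y6, chi3_apply h2, tableEntry,
      ← sum_addChar_mul_eq_zero hϑ (mul_ne_zero A13.ne_zero (neg_ne_zero.mpr t1.ne_zero))]
    exact Finset.sum_congr rfl fun s _ => congrArg ϑ (by ring)
  | y2y4y5 t2 => rw [representative_y2y4y5, chi3_apply_eq_zero h2 ϑ _ t2.ne_zero, tableEntry]
  | y2y1 t2 => rw [representative_y2y1, chi3_apply_eq_zero h2 ϑ _ t2.ne_zero, tableEntry]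
  | y3y5 =>
    rw [representative_y3y5, chi3_apply h2]
    simp [tableEntry, mul_comm]
  | y4 => rw [representative_y4, chi3_apply h2]; simp [tableEntry]
  | y5 => rw [representative_y5, chi3_apply h2]; simp [tableEntry]
  | y6 => rw [representative_y6, chi3_apply h2]; simp [tableEntry]

theorem chi4_apply_representative (A15 : Fˣ) (A23 : F) (c : Column F) :
    (Row.chi4 A15 A23).character ϑ c.representative = tableEntry ϑ (.chi4 A15 A23) c := by
  cases c with
  | one =>
    rw [Column.representative, ← mk_zero h2, chi4_apply h2]
    simp [tableEntry]
  | y1y6 t1 => rw [representative_y1y6, chi4_apply_eq_zero h2 ϑ _ t1.ne_zero, tableEntry]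
  | y2y4y5 t2 t4 t5 =>
    rw [representative_y2y4y5, chi4_apply h2, tableEntry, Finset.sum_mul, Finset.sum_mul]
    refine Finset.sum_congr rfl fun s _ => ?_
    rw [← AddChar.map_add_eq_mul, ← AddChar.map_add_eq_mul]
    exact congrArg ϑ (by ring)
  | y2y1 t2 t1 => rw [representative_y2y1, chi4_apply_eq_zero h2 ϑ _ t1.ne_zero, tableEntry]
  | y3y5 t3 =>
    rw [representative_y3y5, chi4_apply h2, tableEntry, ← sum_addChar_mul_eq_zero hϑ
      (mul_ne_zero (mul_ne_zero h2 A15.ne_zero) (mul_ne_zero h2 t3.ne_zero))]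
    exact Finset.sum_congr rfl fun s _ => congrArg ϑ (by ring)
  | y4 => rw [representative_y4, chi4_apply h2]; simp [tableEntry, mul_comm]
  | y5 => rw [representative_y5, chi4_apply h2]; simp [tableEntry]
  | y6 => rw [representative_y6, chi4_apply h2]; simp [tableEntry]

variable (h3 : (3 : F) ≠ 0)
include h3

theorem chi5_apply_representative (A16 : Fˣ) (A23 A13 : F) (c : Column F) :
    (Row.chi5 A16 A23 A13).character ϑ c.representative = tableEntry ϑ (.chi5 A16 A23 A13) c := by
  cases c with
  | one =>
    rw [Column.representative, ← mk_zero h2, chi5_apply h2]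
    simp [tableEntry]
  | y1y6 t1 => rw [representative_y1y6, chi5_apply_eq_zero h2 ϑ _ t1.ne_zero, tableEntry]
  | y2y4y5 t2 t4 t5 =>
    rw [representative_y2y4y5, chi5_apply h2, tableEntry, Finset.sum_mul, Finset.sum_mul]
    refine Finset.sum_congr rfl fun s _ => ?_
    rw [← AddChar.map_add_eq_mul, ← AddChar.map_add_eq_mul]
    exact congrArg ϑ (by ring)
  | y2y1 t2 t1 => rw [representative_y2y1, chi5_apply_eq_zero h2 ϑ _ t1.ne_zero, tableEntry]
  | y3y5 t3 t5 =>
    rw [representative_y3y5, chi5_apply h2, tableEntry, Finset.sum_mul, Finset.sum_mul]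
    refine Finset.sum_congr rfl fun s _ => ?_
    rw [← AddChar.map_add_eq_mul, ← AddChar.map_add_eq_mul]
    exact congrArg ϑ (by ring)
  | y4 t4 =>
    rw [representative_y4, chi5_apply h2, tableEntry, ← sum_addChar_mul_eq_zero hϑ
      (mul_ne_zero A16.ne_zero (mul_ne_zero h3 t4.ne_zero))]
    exact Finset.sum_congr rfl fun s _ => congrArg ϑ (by ring)
  | y5 => rw [representative_y5, chi5_apply h2]; simp [tableEntry, mul_comm]
  | y6 => rw [representative_y6, chi5_apply h2]; simp [tableEntry]

theorem chi6_apply_representative (A17 : Fˣ) (A12 : F) (c : Column F) :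
    (Row.chi6 A17 A12).character ϑ c.representative = tableEntry ϑ (.chi6 A17 A12) c := by
  cases c with
  | one =>
    rw [Column.representative, ← mk_zero h2, chi6_apply h2]
    simp [tableEntry, pow_two]
  | y1y6 t1 t6 =>
    rw [representative_y1y6, chi6_apply_of_r1_ne_zero h2 ϑ _ t1.ne_zero, tableEntry,
      Finset.mul_sum]
    refine Finset.sum_congr rfl fun s _ => ?_
    rw [← AddChar.map_add_eq_mul, ← AddChar.map_add_eq_mul]
    exact congrArg ϑ (by ring)
  | y2y4y5 t2 =>
    rw [representative_y2y4y5, chi6_apply_eq_zero_of_r2_ne_zero h2 ϑ _ t2.ne_zero, tableEntry]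
  | y2y1 t2 =>
    rw [representative_y2y1, chi6_apply_eq_zero_of_r2_ne_zero h2 ϑ _ t2.ne_zero, tableEntry]
  | y3y5 t3 =>
    rw [representative_y3y5, chi6_apply_eq_zero_of_r3_ne_zero h2 ϑ _ t3.ne_zero, tableEntry]
  | y4 t4 =>
    rw [representative_y4, chi6_apply h2, tableEntry]
    refine Finset.sum_eq_zero fun s _ => ?_
    rw [← sum_addChar_mul_eq_zero hϑ (mul_ne_zero A17.ne_zero (mul_ne_zero h3 t4.ne_zero))]
    exact Finset.sum_congr rfl fun r _ => congrArg ϑ (by ring)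
  | y5 t5 =>
    -- For `y r5` it is the sum over `s` that cancels, so it is made the inner one.
    rw [representative_y5, chi6_apply h2, tableEntry, Finset.sum_comm]
    refine Finset.sum_eq_zero fun r _ => ?_
    rw [← sum_addChar_mul_eq_zero hϑ (mul_ne_zero A17.ne_zero t5.ne_zero)]
    exact Finset.sum_congr rfl fun s _ => congrArg ϑ (by ring)
  | y6 =>
    rw [representative_y6, chi6_apply h2]
    simp [tableEntry, pow_two]
    ring

theorem character_apply_representative (i : Row F) (c : Column F) :
    i.character ϑ c.representative = tableEntry ϑ i c := by
  cases i with
  | lin => exact lin_apply_representative h2 ϑ _ _ c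
  | chi3 => exact chi3_apply_representative h2 hϑ _ c
  | chi4 => exact chi4_apply_representative h2 hϑ _ _ c
  | chi5 => exact chi5_apply_representative h2 hϑ h3 _ _ _ c
  | chi6 => exact chi6_apply_representative h2 hϑ h3 _ _ c

end Values

end G2Syl

/-! ### The character table -/

theorem mainTheorem3 {p : ℕ} [Fact p.Prime] (hp : 3 < p)
    {F : Type*} [Field F] [Fintype F] [CharP F p]
    (ϑ : AddChar F ℂ) (hϑ : ϑ ≠ 1) :
    -- the column headers are representatives of all conjugacy classes, one for each class
    (∀ g : G2Syl.U F, ∃! c : G2Syl.Column F, IsConj c.representative g) ∧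
    -- the row headers are the pairwise orthogonal irreducible characters, each listed once
    (∀ i : G2Syl.Row F, G2Syl.IsIrreducibleCharacter (i.character ϑ)) ∧
    (∀ χ : G2Syl.U F → ℂ, G2Syl.IsIrreducibleCharacter χ →
      ∃! i : G2Syl.Row F, i.character ϑ = χ) ∧
    (∀ i j : G2Syl.Row F, i ≠ j →
      G2Syl.characterInner (i.character ϑ) (j.character ϑ) = 0) ∧
    -- the values
    (∀ (i : G2Syl.Row F) (c : G2Syl.Column F),
      i.character ϑ c.representative = G2Syl.tableEntry ϑ i c) := by
  have hne : ∀ n : ℕ, 0 < n → n < p → (n : F) ≠ 0 := fun n h0 hn h =>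
    Nat.not_dvd_of_pos_of_lt h0 hn ((CharP.cast_eq_zero_iff F p n).mp h)
  have h2 : (2 : F) ≠ 0 := by exact_mod_cast hne 2 (by norm_num) (by omega)
  have h3 : (3 : F) ≠ 0 := by exact_mod_cast hne 3 (by norm_num) hp
  have hirr := G2Syl.isIrreducibleCharacter_character h2 hϑ h3
  obtain ⟨hcol, hrow⟩ := G2Syl.existsUnique_of_card_eq (G2Syl.card_row_eq_card_column F)
    (fun i => i.character ϑ) G2Syl.Column.representative hirr
    (G2Syl.character_injective h2 hϑ h3) (G2Syl.exists_isConj_representative h2 h3)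
  exact ⟨hcol, hirr, hrow, fun i j hij => G2Syl.characterInner_character_of_ne h2 hϑ h3 hij,
    G2Syl.character_apply_representative h2 hϑ h3⟩
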